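/- Let $\mathbb{K}$ be a field of characteristic $0$, let $V$ be a vector space with basis $v_1,\dots,v_N$, and let $q_{ij}\in\mathbb{K}^\times$ $(1\le i,j\le N)$. Equip $V$ with the diagonal braiding $\sigma(v_i\otimes v_j)=q_{ij}\,v_j\otimes v_i$, and for $1\le i\le n-1$ let $\sigma_i=\mathrm{id}^{\otimes(i-1)}\otimes\sigma\otimes\mathrm{id}^{\otimes(n-i-1)}$ on $V^{\otimes n}=T^n(V)$. On $V^{\otimes n}$ consider the operators $$S_n=\sum_{\tau\in\mathfrak{S}_n}T_\tau,\qquad T_n=1+\sigma_{n-1}+\sigma_{n-1}\sigma_{n-2}+\cdots+\sigma_{n-1}\cdots\sigma_1,\qquad U_n=1+\sigma_1+\sigma_1\sigma_2+\cdots+\sigma_1\cdots\sigma_{n-1},$$ where $T_\tau=\sigma_{i_1}\cdots\sigma_{i_r}$ for a reduced expression $\tau=s_{i_1}\cdots s_{i_r}$ in the adjacent transpositions $s_i=(i,i+1)$. Let $\Delta$ be the braided coproduct of the tensor algebra $T(V)$: the algebra map from $T(V)$ to the braided tensor product algebra $T(V)\otimes T(V)$ with $\Delta(v)=v\otimes1+1\otimes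 v$ for $v\in V$. Write $\Delta(x)=\sum x_{(1)}\otimes x_{(2)}$, let $\varphi_i:T(V)\to\mathbb{K}$ be the linear functional that vanishes on $T^n(V)$ for $n\neq1$ and satisfies $\varphi_i(v_j)=\delta_{ij}$, and put $$\partial_i^R(x)=\sum x_{(1)}\varphi_i(x_{(2)}),\qquad \partial_i^L(x)=\sum \varphi_i(x_{(1)})x_{(2)}.$$ For $m\ge 2$ let $R^m$ (respectively $L^m$) be the intersection with $T^m(V)$ of the two-sided ideal of $T(V)$ generated by all right (respectively left) constants of degree $n$ with $2\le n\le m$, that is, by the elements $x\in T^n(V)$ with $T_nx=0$ (respectively $U_nx=0$). Then: 1. For every $n\ge2$ and $x\in T^n(V)$: $T_nx=0$ if and only if $\partial_i^R(x)=0$ for all $i$, and $U_nx=0$ if and only if $\partial_i^L(x)=0$ for all $i$. 2. For every $m\ge2$: $R^m=L^m=\ker (S_m:T^m(V)\to T^m(V))$. 3. For every $m\ge3$ and $x\in T^m(V)$: $x\in R^m$ if and only if $\partial_i^R(x)\in R^{m-1}$ for all $i$, and $x\in L^m$ if and only if $\partial_i^L(x)\in L^{m-1}$ for all $i$. -/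

import Mathlib

open Module
open scoped TensorProduct

namespace DiagonalNichols

section SymmetricGroup

/-- The adjacent transposition exchanging the positions `i` and `i + 1` (numbered from `0`) among
`n` positions. -/
def adjSwap (n : ℕ) (i : Fin (n - 1)) : Equiv.Perm (Fin n) :=
  Equiv.swap ⟨i, by omega⟩ ⟨i + 1, by omega⟩

/-- `l` is a reduced expression of `τ`: the product of the adjacent transpositions listed in `l`
is `τ`, and no shorter list has this product. -/
def IsReducedExpr {n : ℕ} (l : List (Fin (n - 1))) (τ : Equiv.Perm (Fin n)) : Prop :=
  (l.map (adjSwap n)).prod = τ ∧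
    ∀ l' : List (Fin (n - 1)), (l'.map (adjSwap n)).prod = τ → l.length ≤ l'.length

theorem exists_isReducedExpr {n : ℕ} (τ : Equiv.Perm (Fin n)) :
    ∃ l : List (Fin (n - 1)), IsReducedExpr l τ := by
  have hex : ∃ l : List (Fin (n - 1)), (l.map (adjSwap n)).prod = τ := by
    cases n with
    | zero => exact ⟨[], Subsingleton.elim _ _⟩
    | succ m =>
      have hτ : τ ∈ Submonoid.closure (Set.range (adjSwap (m + 1))) := by
        have h := Equiv.Perm.mclosure_swap_castSucc_succ m
        have h' : Set.range (adjSwap (m + 1)) =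
            Set.range (fun i : Fin m => Equiv.swap i.castSucc i.succ) := rfl
        rw [h', h]
        exact Submonoid.mem_top _
      obtain ⟨l, hl, hprod⟩ := Submonoid.exists_list_of_mem_closure hτ
      obtain ⟨l', rfl⟩ : ∃ l' : List (Fin (m + 1 - 1)), l'.map (adjSwap (m + 1)) = l := by
        have := Set.range_list_map (adjSwap (m + 1))
        have hmem : l ∈ {l | ∀ x ∈ l, x ∈ Set.range (adjSwap (m + 1))} := hl
        rw [← this] at hmem
        exact hmem
      exact ⟨l', hprod⟩
  classical
  have hlen : ∃ k, ∃ l : List (Fin (n - 1)), (l.map (adjSwap n)).prod = τ ∧ l.length = k := by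
    obtain ⟨l, hl⟩ := hex
    exact ⟨l.length, l, hl, rfl⟩
  obtain ⟨l, hl, hk⟩ := Nat.find_spec hlen
  refine ⟨l, hl, fun l' hl' => ?_⟩
  rw [hk]
  exact Nat.find_min' hlen ⟨l', hl', rfl⟩

/-- A chosen reduced expression of a permutation. -/
noncomputable def reducedExpr {n : ℕ} (τ : Equiv.Perm (Fin n)) : List (Fin (n - 1)) :=
  (exists_isReducedExpr τ).choose

theorem reducedExpr_spec {n : ℕ} (τ : Equiv.Perm (Fin n)) : IsReducedExpr (reducedExpr τ) τ :=
  (exists_isReducedExpr τ).choose_spec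

end SymmetricGroup

/- Throughout, `V` is a vector space with basis `v_0, …, v_{N-1}` and `q` is a braiding matrix with
nonzero entries; the braiding of `V` is `σ (v_i ⊗ v_j) = q_{ij} v_j ⊗ v_i`. -/
variable {K : Type*} [Field K] {V : Type*} [AddCommGroup V] [Module K V] {N : ℕ}

section BraidOperators

/-- The action on `V^{⊗ n}` of the generator of the braid group with (zero-based) index `i`, that is
`id ⊗ σ ⊗ id` with `σ` at the positions `i` and `i + 1`. On basis tensors,
`v_{w 0} ⊗ ⋯ ⊗ v_{w (n-1)}` is sent to `q_{w i, w (i+1)}` times the tensor with the factors in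
the positions `i` and `i + 1` exchanged. -/
noncomputable def braidGen (v : Basis (Fin N) K V) (q : Fin N → Fin N → Kˣ) (n : ℕ)
    (i : Fin (n - 1)) : Module.End K (⨂[K]^n V) :=
  (Basis.piTensorProduct fun _ : Fin n => v).constr K fun w : Fin n → Fin N =>
    (q (w ⟨i, by omega⟩) (w ⟨i + 1, by omega⟩) : K) •
      PiTensorProduct.tprod K fun k : Fin n => v (w (adjSwap n i k))

/-- The action on `V^{⊗ n}` of the product of braid generators listed in `l`; as usual for a left
action, the last generator in the list is applied first. -/
noncomputable def braidWord (v : Basis (Fin N) K V) (q : Fin N → Fin N → Kˣ) (n : ℕ)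
    (l : List (Fin (n - 1))) : Module.End K (⨂[K]^n V) :=
  (l.map (braidGen v q n)).prod

/-- The total symmetrization operator `S_n = ∑_τ T_τ` on `V^{⊗ n}`, where `T_τ` is the lift of the
permutation `τ` to the braid group through a reduced expression. -/
noncomputable def symmetrizer (v : Basis (Fin N) K V) (q : Fin N → Fin N → Kˣ) (n : ℕ) :
    Module.End K (⨂[K]^n V) :=
  ∑ τ : Equiv.Perm (Fin n), braidWord v q n (reducedExpr τ)

/-- `T_n = 1 + σ_{n-1} + σ_{n-1}σ_{n-2} + ⋯ + σ_{n-1}σ_{n-2}⋯σ_1`, as an operator on `V^{⊗ n}`. -/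
noncomputable def rightDiffElement (v : Basis (Fin N) K V) (q : Fin N → Fin N → Kˣ) (n : ℕ) :
    Module.End K (⨂[K]^n V) :=
  ∑ k ∈ Finset.range n, braidWord v q n ((List.finRange (n - 1)).reverse.take k)

/-- `U_n = 1 + σ_1 + σ_1σ_2 + ⋯ + σ_1σ_2⋯σ_{n-1}`, as an operator on `V^{⊗ n}`. -/
noncomputable def leftDiffElement (v : Basis (Fin N) K V) (q : Fin N → Fin N → Kˣ) (n : ℕ) :
    Module.End K (⨂[K]^n V) :=
  ∑ k ∈ Finset.range n, braidWord v q n ((List.finRange (n - 1)).take k)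

end BraidOperators

section DifferentialOperators

/-- The basis `v_a ⊗ v_b` of `T(V) ⊗ T(V)`, where `a, b` are words in the indices and
`v_a = v_{a_1} ⋯ v_{a_r}`. -/
noncomputable def wordBasis₂ (v : Basis (Fin N) K V) :
    Basis (FreeMonoid (Fin N) × FreeMonoid (Fin N)) K
      (TensorAlgebra K V ⊗[K] TensorAlgebra K V) :=
  v.tensorAlgebra.tensorProduct v.tensorAlgebra

/-- The braiding coefficient of two words: `σ (v_a ⊗ v_b) = (∏_{i ∈ a, j ∈ b} q_{ij}) v_b ⊗ v_a`. -/
def wordCoeff (q : Fin N → Fin N → Kˣ) (a b : FreeMonoid (Fin N)) : K :=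
  (a.toList.map fun i => (b.toList.map fun j => (q i j : K)).prod).prod

/-- The multiplication of the braided tensor product algebra `T(V) ⊗ T(V)`, that is
`(m ⊗ m) ∘ (id ⊗ σ ⊗ id)`. On basis elements,
`(v_a ⊗ v_b) (v_c ⊗ v_d) = (∏_{i ∈ b, j ∈ c} q_{ij}) v_a v_c ⊗ v_b v_d`. -/
noncomputable def braidedMul (v : Basis (Fin N) K V) (q : Fin N → Fin N → Kˣ) :
    (TensorAlgebra K V ⊗[K] TensorAlgebra K V) →ₗ[K]
      (TensorAlgebra K V ⊗[K] TensorAlgebra K V) →ₗ[K]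
        (TensorAlgebra K V ⊗[K] TensorAlgebra K V) :=
  (wordBasis₂ v).constr K fun ab => (wordBasis₂ v).constr K fun cd =>
    wordCoeff q ab.2 cd.1 •
      ((v.tensorAlgebra ab.1 * v.tensorAlgebra cd.1) ⊗ₜ[K]
        (v.tensorAlgebra ab.2 * v.tensorAlgebra cd.2))

variable (K V) in
/-- `x ↦ x ⊗ 1 + 1 ⊗ x` on `V`. -/
noncomputable def primitiveMap : V →ₗ[K] TensorAlgebra K V ⊗[K] TensorAlgebra K V :=
  ((TensorProduct.mk K (TensorAlgebra K V) (TensorAlgebra K V)).flip 1 +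
    TensorProduct.mk K (TensorAlgebra K V) (TensorAlgebra K V) 1) ∘ₗ TensorAlgebra.ι K

/-- The braided coproduct of `T(V)`: the map into the braided tensor product algebra with
`Δ 1 = 1 ⊗ 1` and `Δ (x₁ ⋯ x_n) = Δ x₁ ⋯ Δ x_n`, where `Δ x = x ⊗ 1 + 1 ⊗ x` for `x ∈ V`. It is
obtained by letting `T(V)` act on `T(V) ⊗ T(V)` through left multiplication by the elements `Δ x`
and applying this action to `1 ⊗ 1`. -/
noncomputable def comul (v : Basis (Fin N) K V) (q : Fin N → Fin N → Kˣ) :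
    TensorAlgebra K V →ₗ[K] TensorAlgebra K V ⊗[K] TensorAlgebra K V :=
  LinearMap.applyₗ ((1 : TensorAlgebra K V) ⊗ₜ[K] (1 : TensorAlgebra K V)) ∘ₗ
    (TensorAlgebra.lift K
      (A := Module.End K (TensorAlgebra K V ⊗[K] TensorAlgebra K V))
      (braidedMul v q ∘ₗ primitiveMap K V)).toLinearMap

/-- The functional `φ(v_i, ·)` on `T(V)`: it takes the coefficient of the word `v_i`. This is the
only functional `f` that satisfies `f(v_j) = δ_{ij}` and, because `v_i` is primitive,
`f(1) = 0` and `f(xy) = f(x)ε(y) + ε(x)f(y)`. -/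
noncomputable def pairingGen (v : Basis (Fin N) K V) (i : Fin N) : TensorAlgebra K V →ₗ[K] K :=
  v.tensorAlgebra.coord (FreeMonoid.of i)

/-- `∂_i^R(x) = ∑ x₍₁₎ φ(v_i, x₍₂₎)`. -/
noncomputable def rightDeriv (v : Basis (Fin N) K V) (q : Fin N → Fin N → Kˣ) (i : Fin N) :
    TensorAlgebra K V →ₗ[K] TensorAlgebra K V :=
  (TensorProduct.rid K (TensorAlgebra K V)).toLinearMap ∘ₗ
    (pairingGen v i).lTensor (TensorAlgebra K V) ∘ₗ comul v q

/-- `∂_i^L(x) = ∑ φ(v_i, x₍₁₎) x₍₂₎`. -/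
noncomputable def leftDeriv (v : Basis (Fin N) K V) (q : Fin N → Fin N → Kˣ) (i : Fin N) :
    TensorAlgebra K V →ₗ[K] TensorAlgebra K V :=
  (TensorProduct.lid K (TensorAlgebra K V)).toLinearMap ∘ₗ
    (pairingGen v i).rTensor (TensorAlgebra K V) ∘ₗ comul v q

end DifferentialOperators

section Constants

variable (K V) in
/-- The homogeneous component `T^m(V)` of the tensor algebra. -/
def degreePart (m : ℕ) : Submodule K (TensorAlgebra K V) :=
  LinearMap.range (TensorAlgebra.ι K : V →ₗ[K] TensorAlgebra K V) ^ m

/-- `ker S_m`, viewed inside `T(V)` through the inclusion `V^{⊗ m} → T(V)`. -/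
noncomputable def kerSymmetrizer (v : Basis (Fin N) K V) (q : Fin N → Fin N → Kˣ) (m : ℕ) :
    Submodule K (TensorAlgebra K V) :=
  (LinearMap.ker (symmetrizer v q m)).map TensorPower.toTensorAlgebra

/-- The right constants of degree `n`: the kernel of `T_n` on `V^{⊗ n}`, viewed inside `T(V)`. -/
noncomputable def rightConst (v : Basis (Fin N) K V) (q : Fin N → Fin N → Kˣ) (n : ℕ) :
    Submodule K (TensorAlgebra K V) :=
  (LinearMap.ker (rightDiffElement v q n)).map TensorPower.toTensorAlgebra

/-- The left constants of degree `n`: the kernel of `U_n` on `V^{⊗ n}`, viewed inside `T(V)`. -/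
noncomputable def leftConst (v : Basis (Fin N) K V) (q : Fin N → Fin N → Kˣ) (n : ℕ) :
    Submodule K (TensorAlgebra K V) :=
  (LinearMap.ker (leftDiffElement v q n)).map TensorPower.toTensorAlgebra

/-- The span of the right constants of degree `n` with `2 ≤ n ≤ m`. -/
noncomputable def rightConstLE (v : Basis (Fin N) K V) (q : Fin N → Fin N → Kˣ) (m : ℕ) :
    Submodule K (TensorAlgebra K V) :=
  Submodule.span K (⋃ n ∈ Set.Icc 2 m, (rightConst v q n : Set (TensorAlgebra K V)))

/-- The span of the left constants of degree `n` with `2 ≤ n ≤ m`. -/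
noncomputable def leftConstLE (v : Basis (Fin N) K V) (q : Fin N → Fin N → Kˣ) (m : ℕ) :
    Submodule K (TensorAlgebra K V) :=
  Submodule.span K (⋃ n ∈ Set.Icc 2 m, (leftConst v q n : Set (TensorAlgebra K V)))

/-- The two-sided ideal of `T(V)` generated by a set, as a linear subspace. -/
def idealSpan (s : Set (TensorAlgebra K V)) : Submodule K (TensorAlgebra K V) :=
  (TwoSidedIdeal.asIdeal (TwoSidedIdeal.span s)).restrictScalars K

/-- `R^m`: the degree-`m` part of the two-sided ideal generated by the right constants of degree
between `2` and `m`. -/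
noncomputable def rightPart (v : Basis (Fin N) K V) (q : Fin N → Fin N → Kˣ) (m : ℕ) :
    Submodule K (TensorAlgebra K V) :=
  idealSpan (rightConstLE v q m : Set (TensorAlgebra K V)) ⊓ degreePart K V m

/-- `L^m`: the degree-`m` part of the two-sided ideal generated by the left constants of degree
between `2` and `m`. -/
noncomputable def leftPart (v : Basis (Fin N) K V) (q : Fin N → Fin N → Kˣ) (m : ℕ) :
    Submodule K (TensorAlgebra K V) :=
  idealSpan (leftConstLE v q m : Set (TensorAlgebra K V)) ⊓ degreePart K V m

end Constants

end DiagonalNichols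

/-! Everything is compared with one subspace of T(V): `radical`, the elements x for which ε(∂_{i₁}^R
⋯ ∂_{i_r}^R x) = 0 for every word, ε being the augmentation. In each degree m ≥ 1, the ideals of
right and of left constants and the kernel of S_m all cut out the degree-m part of `radical`.

The radical is symmetric in left and right. Since ε∂_i^R = φ_i = ε∂_i^L and the two families commute
(`leftDeriv_rightDeriv`), right composites can be traded for left ones under ε
(`counit_leftDerivs`). So x is in the radical iff ε(x) = 0 and all its right, equivalently all its
left, derivatives are. The Leibniz rules then make it a two-sided ideal. It contains every constant
of positive degree, hence the ideals these generate.

The converse is the substantial part. If all composites of length j + 1 kill a homogeneous x, its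
derivatives of length j are right constants. As ∂^R on k·b acts only on b when k is a right
constant, x can be corrected by a sum of products (constant)·(degree j) so that composites of length
j vanish too (`exists_sub_rightDerivs_eq_zero`). Descending on j yields `radical_inf_degreePart_le`.
Reversing words and transposing q transfers this to left constants.

The operators enter through T_n x = ∑ ∂_i^R(x) v_i and U_n x = ∑ v_i ∂_i^L(x), in which freeness of
T(V) separates the summands, and through S_{n+1} = (S_n ⊗ id) T_{n+1}. The latter gives ker S_n the
same recursion as the radical (`symmetrizer_eq_zero_iff`); it rests on T_τ being computed from the
inversions of τ. -/

namespace DiagonalNichols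

variable {K : Type*} [Field K] {V : Type*} [AddCommGroup V] [Module K V] {N : ℕ}

/-! ### Monomials, diagonal rescalings and the augmentation of T(V). -/

section Words

/-- The generator `v_i` of `T(V)`. -/
noncomputable def gen (v : Basis (Fin N) K V) (i : Fin N) : TensorAlgebra K V :=
  TensorAlgebra.ι K (v i)

/-- The monomial `v_{i₁} ⋯ v_{i_r}` of `T(V)`. -/
noncomputable def monom (v : Basis (Fin N) K V) (l : List (Fin N)) : TensorAlgebra K V :=
  (l.map (gen v)).prod

@[simp]
theorem monom_nil (v : Basis (Fin N) K V) : monom v [] = 1 := rfl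

@[simp]
theorem monom_cons (v : Basis (Fin N) K V) (i : Fin N) (l : List (Fin N)) :
    monom v (i :: l) = gen v i * monom v l := by
  simp [monom]

theorem monom_append (v : Basis (Fin N) K V) (l l' : List (Fin N)) :
    monom v (l ++ l') = monom v l * monom v l' := by
  simp [monom]

theorem tensorAlgebra_eq_monom (v : Basis (Fin N) K V) (a : FreeMonoid (Fin N)) :
    v.tensorAlgebra a = monom v a.toList := by
  have h : ∀ a, v.tensorAlgebra a = (TensorAlgebra.equivFreeAlgebra v).symm
      (FreeAlgebra.equivMonoidAlgebraFreeMonoid.symm (MonoidAlgebra.of K _ a)) := by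
    simp [Basis.tensorAlgebra, FreeAlgebra.basisFreeMonoid]
  induction a using FreeMonoid.recOn with
  | one => rw [h, map_one, map_one, map_one]; rfl
  | of_mul i a ih =>
    rw [h, map_mul, map_mul, map_mul, ← h a, ih]
    simp [FreeAlgebra.equivMonoidAlgebraFreeMonoid, gen]

theorem tensorAlgebra_ofList (v : Basis (Fin N) K V) (l : List (Fin N)) :
    v.tensorAlgebra (FreeMonoid.ofList l) = monom v l := by
  rw [tensorAlgebra_eq_monom, FreeMonoid.toList_ofList]

/-- Linear maps on `T(V)` that agree on monomials are equal. -/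
theorem linearMap_ext_monom (v : Basis (Fin N) K V) {M : Type*} [AddCommGroup M] [Module K M]
    {f g : TensorAlgebra K V →ₗ[K] M} (h : ∀ l, f (monom v l) = g (monom v l)) : f = g :=
  v.tensorAlgebra.ext fun a => by rw [tensorAlgebra_eq_monom]; exact h _

/-- Induction for equalities of linear maps on `T(V)`, multiplying by generators on the left. -/
theorem linearMap_ext_gen_mul (v : Basis (Fin N) K V) {M : Type*} [AddCommGroup M] [Module K M]
    {f g : TensorAlgebra K V →ₗ[K] M} (h₁ : f 1 = g 1)
    (h : ∀ k x, f x = g x → f (gen v k * x) = g (gen v k * x)) : f = g := by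
  refine linearMap_ext_monom v fun l => ?_
  induction l with
  | nil => simpa using h₁
  | cons k l ih => rw [monom_cons]; exact h k _ ih

/-- The algebra endomorphism of `T(V)` that multiplies `v_i` by `c i`. -/
noncomputable def scale (v : Basis (Fin N) K V) (c : Fin N → K) :
    TensorAlgebra K V →ₐ[K] TensorAlgebra K V :=
  TensorAlgebra.lift K (v.constr K fun i => c i • gen v i)

@[simp]
theorem scale_gen (v : Basis (Fin N) K V) (c : Fin N → K) (i : Fin N) :
    scale v c (gen v i) = c i • gen v i := by
  simp [scale, gen]

theorem scale_monom (v : Basis (Fin N) K V) (c : Fin N → K) (l : List (Fin N)) :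
    scale v c (monom v l) = (l.map c).prod • monom v l := by
  induction l with
  | nil => simp
  | cons i l ih =>
    rw [monom_cons, map_mul, ih, scale_gen, smul_mul_smul_comm, List.map_cons, List.prod_cons]

variable (K V) in
/-- The augmentation of `T(V)`. -/
noncomputable def counit : TensorAlgebra K V →ₐ[K] K := TensorAlgebra.algebraMapInv

@[simp]
theorem counit_gen (v : Basis (Fin N) K V) (i : Fin N) : counit K V (gen v i) = 0 := by
  simp [counit, gen, TensorAlgebra.algebraMapInv]

@[simp]
theorem counit_scale (v : Basis (Fin N) K V) (c : Fin N → K) (x : TensorAlgebra K V) :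
    counit K V (scale v c x) = counit K V x := by
  have : (counit K V).toLinearMap ∘ₗ (scale v c).toLinearMap = (counit K V).toLinearMap :=
    linearMap_ext_gen_mul v (by simp) (by simp)
  exact LinearMap.congr_fun this x

theorem coord_monom (v : Basis (Fin N) K V) (a : FreeMonoid (Fin N)) (l : List (Fin N)) :
    v.tensorAlgebra.coord a (monom v l) = if l = a.toList then 1 else 0 := by
  classical
  rw [← tensorAlgebra_ofList, Basis.coord_apply, Basis.repr_self, Finsupp.single_apply]
  exact if_congr Iff.rfl rfl rfl

@[simp]
theorem pairingGen_one (v : Basis (Fin N) K V) (i : Fin N) : pairingGen v i 1 = 0 := by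
  rw [pairingGen, ← monom_nil v, coord_monom]
  simp

@[simp]
theorem pairingGen_gen_mul (v : Basis (Fin N) K V) (i k : Fin N) (x : TensorAlgebra K V) :
    pairingGen v i (gen v k * x) = (if k = i then 1 else 0) * counit K V x := by
  have : pairingGen v i ∘ₗ LinearMap.mulLeft K (gen v k) =
      (if k = i then 1 else 0 : K) • (counit K V).toLinearMap := by
    refine linearMap_ext_monom v fun l => ?_
    simp only [LinearMap.comp_apply, LinearMap.mulLeft_apply, pairingGen, ← monom_cons,
      coord_monom]
    by_cases h : k = i <;> cases l <;> simp [h]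
  exact LinearMap.congr_fun this x

end Words

/-! ### The braided coproduct and the first Leibniz rules. -/

section Coproduct

variable (v : Basis (Fin N) K V) (q : Fin N → Fin N → Kˣ)

/-- The operator by which `v_k` acts on `T(V)` when it is braided to the right. -/
noncomputable def twist (k : Fin N) : TensorAlgebra K V →ₐ[K] TensorAlgebra K V :=
  scale v fun l => (q k l : K)

@[simp]
theorem twist_gen (k i : Fin N) : twist v q k (gen v i) = (q k i : K) • gen v i :=
  scale_gen v _ i

@[simp]
theorem counit_twist (k : Fin N) (x : TensorAlgebra K V) :
    counit K V (twist v q k x) = counit K V x :=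
  counit_scale v _ x

theorem twist_monom (k : Fin N) (l : List (Fin N)) :
    twist v q k (monom v l) = (l.map fun j => (q k j : K)).prod • monom v l :=
  scale_monom v _ l

/-- Moving v_k past the first tensor factor costs only a diagonal rescaling of that factor, so left
multiplication by Δ(v_k) splits into two elementary tensor maps. This recursion replaces the braided
product from here on. -/
theorem braidedMul_primitiveMap (k : Fin N) :
    braidedMul v q (primitiveMap K V (v k)) =
      TensorProduct.map (LinearMap.mulLeft K (gen v k)) LinearMap.id +
        TensorProduct.map (twist v q k).toLinearMap (LinearMap.mulLeft K (gen v k)) := by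
  refine (wordBasis₂ v).ext fun cd => ?_
  obtain ⟨c, d⟩ := cd
  have h1 : primitiveMap K V (v k) =
      wordBasis₂ v (FreeMonoid.of k, 1) + wordBasis₂ v (1, FreeMonoid.of k) := by
    simp [primitiveMap, wordBasis₂, Basis.tensorProduct_apply, tensorAlgebra_eq_monom, gen]
  rw [h1, map_add, LinearMap.add_apply, LinearMap.add_apply, braidedMul, Basis.constr_basis,
    Basis.constr_basis, Basis.constr_basis, Basis.constr_basis]
  simp [wordBasis₂, Basis.tensorProduct_apply, tensorAlgebra_eq_monom, wordCoeff, twist_monom,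
    TensorProduct.smul_tmul']

@[simp]
theorem comul_one : comul v q 1 = 1 ⊗ₜ 1 := by
  simp [comul]

theorem comul_gen_mul (k : Fin N) (x : TensorAlgebra K V) :
    comul v q (gen v k * x) =
      TensorProduct.map (LinearMap.mulLeft K (gen v k)) LinearMap.id (comul v q x) +
        TensorProduct.map (twist v q k).toLinearMap (LinearMap.mulLeft K (gen v k))
          (comul v q x) := by
  rw [← LinearMap.add_apply, ← braidedMul_primitiveMap]
  simp [comul, gen]

/-- The counit axiom: the summand of Δ(v_k x) that puts v_k into the second factor is killed by ε.
-/
theorem rid_lTensor_counit_comul (x : TensorAlgebra K V) :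
    TensorProduct.rid K _ ((counit K V).toLinearMap.lTensor _ (comul v q x)) = x := by
  have : (TensorProduct.rid K _).toLinearMap ∘ₗ (counit K V).toLinearMap.lTensor _ ∘ₗ
      comul v q = LinearMap.id := by
    refine linearMap_ext_gen_mul v (by simp) fun k x h => ?_
    simp only [LinearMap.comp_apply, LinearEquiv.coe_coe, LinearMap.id_apply] at h
    conv_rhs => rw [LinearMap.id_apply, ← h]
    simp only [LinearMap.comp_apply, LinearEquiv.coe_coe, comul_gen_mul, map_add]
    generalize comul v q x = t
    induction t with
    | zero => simp
    | tmul a b => simp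
    | add a b ha hb => simp only [map_add, mul_add, ← ha, ← hb]; abel
  exact LinearMap.congr_fun this x

theorem lid_rTensor_counit_comul (x : TensorAlgebra K V) :
    TensorProduct.lid K _ ((counit K V).toLinearMap.rTensor _ (comul v q x)) = x := by
  have : (TensorProduct.lid K _).toLinearMap ∘ₗ (counit K V).toLinearMap.rTensor _ ∘ₗ
      comul v q = LinearMap.id := by
    refine linearMap_ext_gen_mul v (by simp) fun k x h => ?_
    simp only [LinearMap.comp_apply, LinearEquiv.coe_coe, LinearMap.id_apply] at h
    conv_rhs => rw [LinearMap.id_apply, ← h]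
    simp only [LinearMap.comp_apply, LinearEquiv.coe_coe, comul_gen_mul, map_add]
    generalize comul v q x = t
    induction t with
    | zero => simp
    | tmul a b => simp
    | add a b ha hb => simp only [map_add, mul_add, ← ha, ← hb]; abel
  exact LinearMap.congr_fun this x

@[simp]
theorem rightDeriv_one (i : Fin N) : rightDeriv v q i 1 = 0 := by
  simp [rightDeriv]

@[simp]
theorem leftDeriv_one (i : Fin N) : leftDeriv v q i 1 = 0 := by
  simp [leftDeriv]

/-- In the summand with v_k in the second factor, φ_i(v_k b) = δ_{ki} ε(b), and the counit axiom
collapses what remains to the twist of x. -/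
theorem rightDeriv_gen_mul (i k : Fin N) (x : TensorAlgebra K V) :
    rightDeriv v q i (gen v k * x) =
      gen v k * rightDeriv v q i x + (if k = i then 1 else 0 : K) • twist v q k x := by
  obtain ⟨t, ht⟩ : ∃ t, comul v q x = t := ⟨_, rfl⟩
  have hx := rid_lTensor_counit_comul v q x
  rw [ht] at hx
  simp only [rightDeriv, LinearMap.comp_apply, LinearEquiv.coe_coe, comul_gen_mul, map_add, ht]
  rw [← hx]
  clear hx ht
  induction t with
  | zero => simp
  | tmul a b => by_cases h : k = i <;> simp [h]
  | add a b ha hb =>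
    simp only [map_add, mul_add, smul_add] at *
    rw [add_add_add_comm, ha, hb]; abel

theorem leftDeriv_gen_mul (i k : Fin N) (x : TensorAlgebra K V) :
    leftDeriv v q i (gen v k * x) =
      (if k = i then 1 else 0 : K) • x + (q k i : K) • (gen v k * leftDeriv v q i x) := by
  have hφ : ∀ a, pairingGen v i (twist v q k a) = (q k i : K) * pairingGen v i a := by
    intro a
    have : pairingGen v i ∘ₗ (twist v q k).toLinearMap = (q k i : K) • pairingGen v i := by
      refine linearMap_ext_gen_mul v (by simp) fun j x _ => ?_
      by_cases h : j = i <;> simp [h]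
    simpa using LinearMap.congr_fun this a
  obtain ⟨t, ht⟩ : ∃ t, comul v q x = t := ⟨_, rfl⟩
  have hx := lid_rTensor_counit_comul v q x
  rw [ht] at hx
  simp only [leftDeriv, LinearMap.comp_apply, LinearEquiv.coe_coe, comul_gen_mul, map_add, ht]
  rw [← hx]
  clear hx ht
  induction t with
  | zero => simp
  | tmul a b => 
    have := hφ a
    by_cases h : k = i
    · subst h; simp [this, mul_smul]
    · simp [h, this, mul_smul]
  | add a b ha hb =>
    simp only [map_add, mul_add, smul_add] at *
    rw [add_add_add_comm, ha, hb]; abel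

/-- The coproduct intertwines `∂_i^R` with `id ⊗ ∂_i^R`. -/
theorem comul_rightDeriv (i : Fin N) (x : TensorAlgebra K V) :
    comul v q (rightDeriv v q i x) = (rightDeriv v q i).lTensor _ (comul v q x) := by
  -- Diagonal rescalings commute with the braiding, hence with Δ; this handles the twist in
  -- `rightDeriv_gen_mul`.
  have htw : ∀ k x, comul v q (twist v q k x) =
      TensorProduct.map (twist v q k).toLinearMap (twist v q k).toLinearMap (comul v q x) := by
    intro k x
    have : comul v q ∘ₗ (twist v q k).toLinearMap =
        TensorProduct.map (twist v q k).toLinearMap (twist v q k).toLinearMap ∘ₗ comul v q := by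
      refine linearMap_ext_gen_mul v (by simp) fun j x h => ?_
      simp only [LinearMap.comp_apply, AlgHom.toLinearMap_apply] at h ⊢
      simp only [map_mul, twist_gen, smul_mul_assoc, map_smul, comul_gen_mul, h, map_add, smul_add]
      generalize comul v q x = t
      induction t with
      | zero => simp
      | tmul a b =>
        have hc : twist v q j (twist v q k a) = twist v q k (twist v q j a) := by
          have : (twist v q j).toLinearMap ∘ₗ (twist v q k).toLinearMap =
              (twist v q k).toLinearMap ∘ₗ (twist v q j).toLinearMap :=
            linearMap_ext_monom v fun l => by
              simp only [LinearMap.comp_apply, AlgHom.toLinearMap_apply, twist_monom, map_smul]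
              rw [smul_comm]
          exact LinearMap.congr_fun this a
        simp [hc, TensorProduct.smul_tmul']
      | add a b ha hb =>
        simp only [map_add, smul_add] at *
        rw [add_add_add_comm, ha, hb]; abel
    exact LinearMap.congr_fun this x
  have : comul v q ∘ₗ rightDeriv v q i = (rightDeriv v q i).lTensor _ ∘ₗ comul v q := by
    refine linearMap_ext_gen_mul v (by simp) fun k x h => ?_
    simp only [LinearMap.comp_apply] at h ⊢
    rw [rightDeriv_gen_mul, map_add, map_smul, comul_gen_mul, comul_gen_mul, htw, h]
    generalize comul v q x = t
    induction t with
    | zero => simp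
    | tmul a b =>
      by_cases h : k = i
      · simp [h, rightDeriv_gen_mul, TensorProduct.tmul_add]; abel
      · simp [h, rightDeriv_gen_mul]
    | add a b ha hb =>
      simp only [map_add, smul_add] at *
      rw [add_add_add_comm (LinearMap.lTensor _ _ _), ← ha, ← hb]; abel
  exact LinearMap.congr_fun this x

end Coproduct

/-! ### Leibniz rules on both sides and commutation of ∂^L with ∂^R. -/

section Derivations

variable (v : Basis (Fin N) K V) (q : Fin N → Fin N → Kˣ)

theorem rightDeriv_gen (i k : Fin N) :
    rightDeriv v q i (gen v k) = (if k = i then 1 else 0 : K) • 1 := by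
  simpa using rightDeriv_gen_mul v q i k 1

theorem leftDeriv_gen (i k : Fin N) :
    leftDeriv v q i (gen v k) = (if k = i then 1 else 0 : K) • 1 := by
  simpa using leftDeriv_gen_mul v q i k 1

/-- Peeling off the last letter, unlike the first, leaves the other factor x untwisted; the ideal
property and the treatment of constants depend on this form. -/
theorem rightDeriv_mul_gen (i k : Fin N) (x : TensorAlgebra K V) :
    rightDeriv v q i (x * gen v k) =
      (if k = i then 1 else 0 : K) • x + (q i k : K) • (rightDeriv v q i x * gen v k) := by
  have : rightDeriv v q i ∘ₗ LinearMap.mulRight K (gen v k) =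
      (if k = i then 1 else 0 : K) • LinearMap.id +
        (q i k : K) • (LinearMap.mulRight K (gen v k) ∘ₗ rightDeriv v q i) := by
    refine linearMap_ext_gen_mul v
      (by by_cases h : k = i <;> simp [rightDeriv_gen, h]) fun j x h => ?_
    simp only [LinearMap.comp_apply, LinearMap.mulRight_apply, LinearMap.add_apply,
      LinearMap.smul_apply, LinearMap.id_apply] at h ⊢
    rw [mul_assoc, rightDeriv_gen_mul, h, rightDeriv_gen_mul, map_mul, twist_gen]
    by_cases hj : j = i
    · subst hj
      simp only [mul_add, add_mul, smul_add, mul_smul_comm, mul_assoc, if_true, one_smul]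
      abel
    · simp only [mul_add, mul_smul_comm, mul_assoc, hj, if_false, zero_smul, add_zero]
  exact LinearMap.congr_fun this x

theorem leftDeriv_mul_gen (i k : Fin N) (x : TensorAlgebra K V) :
    leftDeriv v q i (x * gen v k) =
      leftDeriv v q i x * gen v k +
        (if k = i then 1 else 0 : K) • scale v (fun l => (q l i : K)) x := by
  have : leftDeriv v q i ∘ₗ LinearMap.mulRight K (gen v k) =
      LinearMap.mulRight K (gen v k) ∘ₗ leftDeriv v q i +
        (if k = i then 1 else 0 : K) • (scale v fun l => (q l i : K)).toLinearMap := by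
    refine linearMap_ext_gen_mul v
      (by by_cases h : k = i <;> simp [leftDeriv_gen, h]) fun j x h => ?_
    simp only [LinearMap.comp_apply, LinearMap.mulRight_apply, LinearMap.add_apply,
      LinearMap.smul_apply, AlgHom.toLinearMap_apply] at h ⊢
    rw [mul_assoc, leftDeriv_gen_mul, h, leftDeriv_gen_mul, map_mul, scale_gen]
    simp only [mul_add, add_mul, smul_add, mul_smul_comm, smul_mul_assoc, mul_assoc, add_assoc]
    congr 2
    rw [smul_comm]
  exact LinearMap.congr_fun this x

theorem leftDeriv_twist (i j : Fin N) (x : TensorAlgebra K V) :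
    leftDeriv v q i (twist v q j x) = (q j i : K) • twist v q j (leftDeriv v q i x) := by
  have : leftDeriv v q i ∘ₗ (twist v q j).toLinearMap =
      (q j i : K) • ((twist v q j).toLinearMap ∘ₗ leftDeriv v q i) := by
    refine linearMap_ext_gen_mul v (by simp) fun k x h => ?_
    simp only [LinearMap.comp_apply, AlgHom.toLinearMap_apply, LinearMap.smul_apply] at h ⊢
    rw [map_mul, twist_gen, smul_mul_assoc, map_smul, leftDeriv_gen_mul, h, leftDeriv_gen_mul,
      map_add, map_smul, map_smul, map_mul, twist_gen]
    by_cases hk : k = i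
    · subst hk
      simp only [smul_add, mul_smul_comm, smul_mul_assoc, if_true, one_smul]
    · simp only [hk, if_false, zero_smul, zero_add, mul_smul_comm, smul_mul_assoc]
      rw [smul_comm (q j i : K) (q k i : K), smul_comm (q j i : K) (q j k : K)]
      rw [smul_comm (q k i : K) (q j k : K)]
  exact LinearMap.congr_fun this x

/-- The derivations act at opposite ends of Δ. On generators, the scalar that ∂_i^L acquires when
passing v_k equals the one it acquires from the twist by v_k (`leftDeriv_twist`). -/
theorem leftDeriv_rightDeriv (i j : Fin N) (x : TensorAlgebra K V) :
    leftDeriv v q i (rightDeriv v q j x) = rightDeriv v q j (leftDeriv v q i x) := by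
  have : leftDeriv v q i ∘ₗ rightDeriv v q j = rightDeriv v q j ∘ₗ leftDeriv v q i := by
    refine linearMap_ext_gen_mul v (by simp) fun k x h => ?_
    simp only [LinearMap.comp_apply] at h ⊢
    rw [rightDeriv_gen_mul, map_add, map_smul, leftDeriv_gen_mul, leftDeriv_gen_mul, map_add,
      map_smul, map_smul, rightDeriv_gen_mul, h, leftDeriv_twist]
    by_cases hk : k = j
    · subst hk
      simp only [smul_add, if_true, one_smul, add_assoc]
    · simp only [hk, if_false, zero_smul, add_zero]
  exact LinearMap.congr_fun this x

theorem counit_rightDeriv (i : Fin N) (x : TensorAlgebra K V) :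
    counit K V (rightDeriv v q i x) = pairingGen v i x := by
  have : (counit K V).toLinearMap ∘ₗ rightDeriv v q i = pairingGen v i :=
    linearMap_ext_gen_mul v (by simp) fun k x _ => by
      by_cases h : k = i <;> simp [rightDeriv_gen_mul, h]
  exact LinearMap.congr_fun this x

theorem counit_leftDeriv (i : Fin N) (x : TensorAlgebra K V) :
    counit K V (leftDeriv v q i x) = pairingGen v i x := by
  have : (counit K V).toLinearMap ∘ₗ leftDeriv v q i = pairingGen v i :=
    linearMap_ext_gen_mul v (by simp) fun k x _ => by
      by_cases h : k = i <;> simp [leftDeriv_gen_mul, h]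
  exact LinearMap.congr_fun this x

/-- The composite `∂_{i₁}^R ⋯ ∂_{i_r}^R`. -/
noncomputable def rightDerivs (u : List (Fin N)) : Module.End K (TensorAlgebra K V) :=
  (u.map (rightDeriv v q)).prod

/-- The composite `∂_{i_r}^L ⋯ ∂_{i₁}^L`. -/
noncomputable def leftDerivs (u : List (Fin N)) : Module.End K (TensorAlgebra K V) :=
  (u.reverse.map (leftDeriv v q)).prod

@[simp]
theorem rightDerivs_nil (x : TensorAlgebra K V) : rightDerivs v q [] x = x := rfl

@[simp]
theorem rightDerivs_cons (i : Fin N) (u : List (Fin N)) (x : TensorAlgebra K V) :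
    rightDerivs v q (i :: u) x = rightDeriv v q i (rightDerivs v q u x) := by
  simp [rightDerivs]

theorem rightDerivs_append (u u' : List (Fin N)) (x : TensorAlgebra K V) :
    rightDerivs v q (u ++ u') x = rightDerivs v q u (rightDerivs v q u' x) := by
  simp [rightDerivs]

@[simp]
theorem leftDerivs_nil (x : TensorAlgebra K V) : leftDerivs v q [] x = x := rfl

@[simp]
theorem leftDerivs_cons (i : Fin N) (u : List (Fin N)) (x : TensorAlgebra K V) :
    leftDerivs v q (i :: u) x = leftDerivs v q u (leftDeriv v q i x) := by
  simp [leftDerivs]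

/-- The outermost ∂_i^R under ε may be replaced by ∂_i^L, which then commutes inward past the
remaining right derivations. This explains the opposite orders of composition in `leftDerivs` and
`rightDerivs`. -/
theorem counit_leftDerivs (u : List (Fin N)) (x : TensorAlgebra K V) :
    counit K V (leftDerivs v q u x) = counit K V (rightDerivs v q u x) := by
  induction u generalizing x with
  | nil => rfl
  | cons i u ih =>
    have hc : ∀ u x, leftDeriv v q i (rightDerivs v q u x) =
        rightDerivs v q u (leftDeriv v q i x) := by
      intro u x
      induction u with
      | nil => rfl
      | cons j u ih => rw [rightDerivs_cons, leftDeriv_rightDeriv, ih, rightDerivs_cons]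
    rw [leftDerivs_cons, ih, rightDerivs_cons, counit_rightDeriv, ← counit_leftDeriv v q, hc]

/-! ### The radical and its two-sided ideal property. -/

/-- The largest ideal in the augmentation ideal that is stable under all `∂_i^R`: the elements on
which all composites of derivations have zero constant term. -/
noncomputable def radical : Submodule K (TensorAlgebra K V) :=
  ⨅ u : List (Fin N), LinearMap.ker ((counit K V).toLinearMap ∘ₗ rightDerivs v q u)

theorem mem_radical {x : TensorAlgebra K V} :
    x ∈ radical v q ↔ ∀ u, counit K V (rightDerivs v q u x) = 0 := by
  simp [radical]

theorem mem_radical_iff_rightDeriv {x : TensorAlgebra K V} :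
    x ∈ radical v q ↔ counit K V x = 0 ∧ ∀ i, rightDeriv v q i x ∈ radical v q := by
  simp only [mem_radical]
  constructor
  · exact fun h => ⟨h [], fun i u => by simpa [rightDerivs_append] using h (u ++ [i])⟩
  · rintro ⟨h, h'⟩ u
    rcases List.eq_nil_or_concat u with rfl | ⟨u, i, rfl⟩
    · exact h
    · simpa [rightDerivs_append] using h' i u

theorem mem_radical_iff_leftDeriv {x : TensorAlgebra K V} :
    x ∈ radical v q ↔ counit K V x = 0 ∧ ∀ i, leftDeriv v q i x ∈ radical v q := by
  simp only [mem_radical, ← counit_leftDerivs]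
  constructor
  · exact fun h => ⟨h [], fun i u => by simpa using h (i :: u)⟩
  · rintro ⟨h, h'⟩ (_ | ⟨i, u⟩)
    · exact h
    · simpa using h' i u

/-- Left derivations are the right tool here: ∂_i^L(v_k x) is a combination of x and v_k ∂_i^L(x),
without a twist. -/
theorem gen_mul_mem_radical (k : Fin N) {x : TensorAlgebra K V} (hx : x ∈ radical v q) :
    gen v k * x ∈ radical v q := by
  rw [mem_radical]
  intro u
  rw [← counit_leftDerivs]
  induction u generalizing x with
  | nil => simp
  | cons i u ih =>
    rw [leftDerivs_cons, leftDeriv_gen_mul, map_add, map_smul, map_smul, map_add, map_smul,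
      map_smul, ih (((mem_radical_iff_leftDeriv v q).1 hx).2 i), counit_leftDerivs,
      (mem_radical v q).1 hx]
    simp

theorem mul_gen_mem_radical (k : Fin N) {x : TensorAlgebra K V} (hx : x ∈ radical v q) :
    x * gen v k ∈ radical v q := by
  rw [mem_radical]
  intro u
  -- The last entry of u acts first, so the induction must run from the end of the word.
  rw [← List.reverse_reverse u]
  induction u.reverse generalizing x with
  | nil => simp
  | cons i u ih =>
    rw [List.reverse_cons, rightDerivs_append, rightDerivs_cons, rightDerivs_nil,
      rightDeriv_mul_gen, map_add, map_smul, map_smul, map_add, map_smul, map_smul,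
      ih (((mem_radical_iff_rightDeriv v q).1 hx).2 i), (mem_radical v q).1 hx]
    simp

theorem mul_mem_radical_left (y : TensorAlgebra K V) {x : TensorAlgebra K V}
    (hx : x ∈ radical v q) : y * x ∈ radical v q := by
  rw [← v.tensorAlgebra.linearCombination_repr y, Finsupp.linearCombination_apply, Finsupp.sum,
    Finset.sum_mul]
  refine Submodule.sum_mem _ fun a _ => ?_
  rw [smul_mul_assoc, tensorAlgebra_eq_monom]
  refine Submodule.smul_mem _ _ ?_
  induction a.toList with
  | nil => simpa using hx
  | cons i l ih => rw [monom_cons, mul_assoc]; exact gen_mul_mem_radical v q i ih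

theorem mul_mem_radical_right (y : TensorAlgebra K V) {x : TensorAlgebra K V}
    (hx : x ∈ radical v q) : x * y ∈ radical v q := by
  rw [← v.tensorAlgebra.linearCombination_repr y, Finsupp.linearCombination_apply, Finsupp.sum,
    Finset.mul_sum]
  refine Submodule.sum_mem _ fun a _ => ?_
  rw [mul_smul_comm, tensorAlgebra_eq_monom]
  refine Submodule.smul_mem _ _ ?_
  induction a.toList generalizing x with
  | nil => simpa using hx
  | cons i l ih => rw [monom_cons, ← mul_assoc]; exact ih (mul_gen_mem_radical v q i hx)

theorem idealSpan_le_radical {s : Set (TensorAlgebra K V)} (hs : s ⊆ radical v q) :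
    idealSpan s ≤ radical v q := by
  intro x hx
  have h : TwoSidedIdeal.span s ≤ TwoSidedIdeal.mk' (radical v q : Set (TensorAlgebra K V))
      (zero_mem _) (add_mem · ·) (neg_mem ·) (mul_mem_radical_left v q _ ·)
      (mul_mem_radical_right v q _ ·) :=
    TwoSidedIdeal.span_le.2 (by rw [TwoSidedIdeal.coe_mk']; exact hs)
  have := h hx
  rwa [TwoSidedIdeal.mem_mk'] at this

end Derivations

/-! ### The grading and its behaviour under derivations. -/

section Degree

variable (v : Basis (Fin N) K V) (q : Fin N → Fin N → Kˣ)

theorem degreePart_eq_span (m : ℕ) :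
    degreePart K V m = Submodule.span K {x | ∃ l : List (Fin N), l.length = m ∧ x = monom v l} := by
  induction m with
  | zero =>
    have : {x | ∃ l : List (Fin N), l.length = 0 ∧ x = monom v l} = {1} := by
      ext x; simp [List.length_eq_zero_iff]
    rw [this, degreePart, pow_zero, Submodule.one_eq_span]
  | succ m ih =>
    have hι : LinearMap.range (TensorAlgebra.ι K : V →ₗ[K] TensorAlgebra K V) =
        Submodule.span K (Set.range (gen v)) := by
      rw [LinearMap.range_eq_map, ← v.span_eq, Submodule.map_span, ← Set.range_comp]
      rfl
    rw [degreePart, pow_succ', ← degreePart, ih, hι, Submodule.span_mul_span]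
    congr 1
    ext x
    constructor
    · rintro ⟨_, ⟨k, rfl⟩, _, ⟨l, hl, rfl⟩, rfl⟩
      exact ⟨k :: l, by simp [hl], by simp⟩
    · rintro ⟨_ | ⟨k, l⟩, hl, rfl⟩
      · simp at hl
      · exact ⟨_, ⟨k, rfl⟩, _, ⟨l, by simpa using hl, rfl⟩, by simp⟩

theorem monom_mem_degreePart (l : List (Fin N)) : monom v l ∈ degreePart K V l.length := by
  rw [degreePart_eq_span v]
  exact Submodule.subset_span ⟨l, rfl, rfl⟩

theorem gen_mem_degreePart (i : Fin N) : gen v i ∈ degreePart K V 1 := by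
  simpa using monom_mem_degreePart v [i]

theorem mul_mem_degreePart {x y : TensorAlgebra K V} {m n : ℕ} (hx : x ∈ degreePart K V m)
    (hy : y ∈ degreePart K V n) : x * y ∈ degreePart K V (m + n) := by
  rw [degreePart, pow_add]
  exact Submodule.mul_mem_mul hx hy

theorem degreePart_le_of_monom (v : Basis (Fin N) K V) {m : ℕ}
    {S : Submodule K (TensorAlgebra K V)}
    (h : ∀ l : List (Fin N), l.length = m → monom v l ∈ S) : degreePart K V m ≤ S := by
  rw [degreePart_eq_span v, Submodule.span_le]
  rintro _ ⟨l, hl, rfl⟩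
  exact h l hl

theorem rightDeriv_mem_degreePart (i : Fin N) {m : ℕ} {x : TensorAlgebra K V}
    (hx : x ∈ degreePart K V (m + 1)) : rightDeriv v q i x ∈ degreePart K V m := by
  refine degreePart_le_of_monom v (S := (degreePart K V m).comap (rightDeriv v q i)) ?_ hx
  intro l hl
  clear hx
  rw [Submodule.mem_comap]
  induction l generalizing m with
  | nil => simp
  | cons k l ih =>
    obtain rfl : l.length = m := by simpa using hl
    rw [monom_cons, rightDeriv_gen_mul, twist_monom]
    refine add_mem ?_ (Submodule.smul_mem _ _ (Submodule.smul_mem _ _ (monom_mem_degreePart v l)))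
    cases l with
    | nil => simp
    | cons j l =>
      rw [List.length_cons, add_comm]
      exact mul_mem_degreePart (gen_mem_degreePart v k) (ih rfl)

theorem leftDeriv_mem_degreePart (i : Fin N) {m : ℕ} {x : TensorAlgebra K V}
    (hx : x ∈ degreePart K V (m + 1)) : leftDeriv v q i x ∈ degreePart K V m := by
  refine degreePart_le_of_monom v (S := (degreePart K V m).comap (leftDeriv v q i)) ?_ hx
  intro l hl
  clear hx
  rw [Submodule.mem_comap]
  induction l generalizing m with
  | nil => simp
  | cons k l ih =>
    obtain rfl : l.length = m := by simpa using hl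
    rw [monom_cons, leftDeriv_gen_mul]
    refine add_mem (Submodule.smul_mem _ _ (monom_mem_degreePart v l)) (Submodule.smul_mem _ _ ?_)
    cases l with
    | nil => simp
    | cons j l =>
      rw [List.length_cons, add_comm]
      exact mul_mem_degreePart (gen_mem_degreePart v k) (ih rfl)

theorem eq_algebraMap_counit (v : Basis (Fin N) K V) {x : TensorAlgebra K V}
    (hx : x ∈ degreePart K V 0) : x = algebraMap K _ (counit K V x) := by
  rw [degreePart_eq_span v] at hx
  induction hx using Submodule.span_induction with
  | mem x h =>
    obtain ⟨l, hl, rfl⟩ := h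
    obtain rfl := List.length_eq_zero_iff.1 hl
    simp
  | zero => simp
  | add x y _ _ hx hy => rw [map_add, map_add, ← hx, ← hy]
  | smul a x _ hx => rw [map_smul, smul_eq_mul, map_mul, ← hx, Algebra.smul_def]

theorem counit_eq_zero_of_mem_degreePart (v : Basis (Fin N) K V) {m : ℕ} {x : TensorAlgebra K V}
    (hx : x ∈ degreePart K V (m + 1)) : counit K V x = 0 := by
  refine degreePart_le_of_monom v (S := LinearMap.ker (counit K V).toLinearMap) ?_ hx
  rintro (_ | ⟨k, l⟩) hl <;> simp at hl ⊢

theorem rightDeriv_eq_zero_of_mem_degreePart_zero (i : Fin N) {x : TensorAlgebra K V}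
    (hx : x ∈ degreePart K V 0) : rightDeriv v q i x = 0 := by
  rw [eq_algebraMap_counit v hx, Algebra.algebraMap_eq_smul_one, map_smul, rightDeriv_one,
    smul_zero]

theorem rightDerivs_mem_degreePart (u : List (Fin N)) {m : ℕ} {x : TensorAlgebra K V}
    (hx : x ∈ degreePart K V (m + u.length)) : rightDerivs v q u x ∈ degreePart K V m := by
  induction u generalizing m with
  | nil => simpa using hx
  | cons i u ih =>
    rw [rightDerivs_cons]
    refine rightDeriv_mem_degreePart v q i (ih ?_)
    rwa [List.length_cons, add_comm u.length, ← add_assoc] at hx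

/-- Too few derivations leave positive degree, where ε vanishes; too many differentiate a scalar. -/
theorem counit_rightDerivs_eq_zero (u : List (Fin N)) {m : ℕ} {x : TensorAlgebra K V}
    (hx : x ∈ degreePart K V m) (h : u.length ≠ m) : counit K V (rightDerivs v q u x) = 0 := by
  rcases lt_or_gt_of_ne h with h | h
  · obtain ⟨k, rfl⟩ := Nat.exists_eq_add_of_lt h
    refine counit_eq_zero_of_mem_degreePart v (m := k) (rightDerivs_mem_degreePart v q u ?_)
    rwa [show u.length + k + 1 = k + 1 + u.length by omega] at hx
  · suffices rightDerivs v q u x = 0 by rw [this, map_zero]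
    induction u with
    | nil => simp at h
    | cons i u ih =>
      rw [rightDerivs_cons]
      rcases Nat.lt_succ_iff_lt_or_eq.1 h with h | rfl
      · rw [ih h.ne' h, map_zero]
      · exact rightDeriv_eq_zero_of_mem_degreePart_zero v q i
          (rightDerivs_mem_degreePart v q u (by simpa using hx))

end Degree

/-! ### Writing the radical in terms of right constants. -/

section Decomposition

variable (v : Basis (Fin N) K V) (q : Fin N → Fin N → Kˣ)

/-- The homogeneous elements of degree `d` on which all `∂_i^R` vanish. -/
noncomputable def rightConstants (d : ℕ) : Submodule K (TensorAlgebra K V) :=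
  degreePart K V d ⊓ ⨅ i, LinearMap.ker (rightDeriv v q i)

theorem mem_rightConstants {d : ℕ} {x : TensorAlgebra K V} :
    x ∈ rightConstants v q d ↔ x ∈ degreePart K V d ∧ ∀ i, rightDeriv v q i x = 0 := by
  simp [rightConstants]

/-- Induction on the last letter of b, using that `rightDeriv_mul_gen` does not twist the left
factor. -/
theorem rightDeriv_mul_of_constant {k : TensorAlgebra K V} (hk : ∀ i, rightDeriv v q i k = 0)
    (i : Fin N) (b : TensorAlgebra K V) :
    rightDeriv v q i (k * b) = k * rightDeriv v q i b := by
  have : rightDeriv v q i ∘ₗ LinearMap.mulLeft K k =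
      LinearMap.mulLeft K k ∘ₗ rightDeriv v q i := by
    refine linearMap_ext_monom v fun l => ?_
    simp only [LinearMap.comp_apply, LinearMap.mulLeft_apply]
    induction l using List.reverseRecOn with
    | nil => simp [hk]
    | append_singleton l j ih =>
      rw [monom_append, monom_cons, monom_nil, mul_one, ← mul_assoc, rightDeriv_mul_gen, ih,
        rightDeriv_mul_gen]
      simp only [mul_add, mul_smul_comm, mul_assoc]
  exact LinearMap.congr_fun this b

theorem rightDerivs_mul_of_constant {k : TensorAlgebra K V} (hk : ∀ i, rightDeriv v q i k = 0)
    (u : List (Fin N)) (b : TensorAlgebra K V) :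
    rightDerivs v q u (k * b) = k * rightDerivs v q u b := by
  induction u with
  | nil => rfl
  | cons i u ih => rw [rightDerivs_cons, ih, rightDeriv_mul_of_constant v q hk, rightDerivs_cons]

theorem comul_rightDerivs (u : List (Fin N)) (x : TensorAlgebra K V) :
    comul v q (rightDerivs v q u x) = (rightDerivs v q u).lTensor _ (comul v q x) := by
  induction u with
  | nil => exact (LinearMap.lTensor_id_apply _ _ (comul v q x)).symm
  | cons i u ih =>
    rw [rightDerivs_cons, comul_rightDeriv, ih, ← LinearMap.comp_apply, ← LinearMap.lTensor_comp]
    rfl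

/-- A linear combination of composites of derivations is determined by its constant terms. -/
theorem sum_rightDerivs_eq_zero {W : Type*} [Fintype W] (u : W → List (Fin N)) (c : W → K)
    (h : ∀ l, ∑ w, c w * counit K V (rightDerivs v q (u w) (monom v l)) = 0)
    (x : TensorAlgebra K V) : ∑ w, c w • rightDerivs v q (u w) x = 0 := by
  have h0 : ∑ w, c w • ((counit K V).toLinearMap ∘ₗ rightDerivs v q (u w)) = 0 :=
    linearMap_ext_monom v fun l => by simpa using h l
  -- Each composite ∂_u is recovered from the functional ε∂_u as (id ⊗ ε∂_u)Δ, so linear relations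
  -- among functionals lift to operators.
  have h1 : ∀ w, rightDerivs v q (u w) x = TensorProduct.rid K _
      (((counit K V).toLinearMap ∘ₗ rightDerivs v q (u w)).lTensor _ (comul v q x)) := by
    intro w
    rw [LinearMap.lTensor_comp, LinearMap.comp_apply, ← comul_rightDerivs,
      rid_lTensor_counit_comul]
  have h2 := congrArg (fun f => TensorProduct.rid K _
    (LinearMap.lTensorHom (R := K) (TensorAlgebra K V) f (comul v q x))) h0
  simpa [← h1] using h2

/-- The correction is z = ∑_w ∂_w(x) b_w, a Taylor-like term: the ∂_w(x) are constants, so ∂_u z =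
∑_w ∂_w(x) ε(∂_u b_w). Dual elements b_w need not exist since the functionals ε∂_w may be dependent;
a projection onto the attainable value vectors provides substitutes. -/
theorem exists_sub_rightDerivs_eq_zero {d j : ℕ} {x : TensorAlgebra K V}
    (hx : x ∈ degreePart K V (d + j))
    (h : ∀ u : List (Fin N), u.length = j + 1 → rightDerivs v q u x = 0) :
    ∃ z ∈ rightConstants v q d * degreePart K V j,
      ∀ u : List (Fin N), u.length = j → rightDerivs v q u (x - z) = 0 := by
  classical
  let Φ : TensorAlgebra K V →ₗ[K] ((Fin j → Fin N) → K) :=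
    LinearMap.pi fun w => (counit K V).toLinearMap ∘ₗ rightDerivs v q (List.ofFn w)
  have hΦ : ∀ y w, Φ y w = counit K V (rightDerivs v q (List.ofFn w) y) := fun y w => rfl
  let M := (degreePart K V j).map Φ
  -- A linear projection of K^W onto M; b_w will be a preimage under Φ of the projected unit vector
  -- e_w.
  obtain ⟨p, hp⟩ := LinearMap.exists_leftInverse_of_injective M.subtype M.ker_subtype
  have hpM : ∀ m ∈ M, (p m : (Fin j → Fin N) → K) = m := fun m hm =>
    congrArg Subtype.val (LinearMap.congr_fun hp ⟨m, hm⟩)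
  have hmem : ∀ w, ∃ b ∈ degreePart K V j, Φ b = p (Pi.single w 1) := fun w =>
    (p (Pi.single w 1)).2
  choose b hb hbΦ using hmem
  -- The family (∂_w x)_w obeys every linear relation valid on M, so p fixes it although its entries
  -- lie in T(V).
  have hfix : ∀ w, ∑ w', (p (Pi.single w' 1) : (Fin j → Fin N) → K) w •
      rightDerivs v q (List.ofFn w') x = rightDerivs v q (List.ofFn w) x := by
    intro w
    have h0 := sum_rightDerivs_eq_zero v q (W := Fin j → Fin N) (fun w' => List.ofFn w')
      (fun w' => (p (Pi.single w' 1) : (Fin j → Fin N) → K) w -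
        (Pi.single w' 1 : (Fin j → Fin N) → K) w) ?_ x
    · simp only [sub_smul, Finset.sum_sub_distrib, sub_eq_zero] at h0
      rw [h0]
      simp [Pi.single_apply]
    · intro l
      by_cases hl : l.length = j
      · have hm : Φ (monom v l) ∈ M := ⟨_, hl ▸ monom_mem_degreePart v l, rfl⟩
        have h1 := hpM _ hm
        have h2 : Φ (monom v l) = ∑ w', Φ (monom v l) w' • Pi.single w' (1 : K) := by
          ext w; simp [Pi.single_apply]
        have h3 := congrFun h1 w
        conv_lhs at h3 => rw [h2, map_sum]
        simp only [map_smul, Submodule.coe_sum, Submodule.coe_smul, Finset.sum_apply,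
          Pi.smul_apply, smul_eq_mul, hΦ] at h3
        simp only [mul_comm _ (counit K V _), mul_sub, Finset.sum_sub_distrib, h3]
        simp [Pi.single_apply]
      · refine Finset.sum_eq_zero fun w' _ => ?_
        rw [counit_rightDerivs_eq_zero v q _ (monom_mem_degreePart v l) (by simpa using Ne.symm hl),
          mul_zero]
  have hconst : ∀ w : Fin j → Fin N, rightDerivs v q (List.ofFn w) x ∈ rightConstants v q d := by
    intro w
    rw [mem_rightConstants]
    refine ⟨rightDerivs_mem_degreePart v q _ (by simpa using hx), fun i => ?_⟩
    rw [← rightDerivs_cons]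
    exact h _ (by simp)
  refine ⟨∑ w, rightDerivs v q (List.ofFn w) x * b w,
    Submodule.sum_mem _ fun w _ => Submodule.mul_mem_mul (hconst w) (hb w), fun u hu => ?_⟩
  obtain ⟨w, rfl⟩ : ∃ w : Fin j → Fin N, List.ofFn w = u :=
    ⟨fun i => u.get (i.cast hu.symm), by subst hu; simp⟩
  have hval : ∀ w', rightDerivs v q (List.ofFn w) (b w') =
      algebraMap K _ ((p (Pi.single w' 1) : (Fin j → Fin N) → K) w) := by
    intro w'
    rw [← hbΦ, hΦ]
    exact eq_algebraMap_counit v (rightDerivs_mem_degreePart v q _ (by simpa using hb w'))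
  rw [map_sub, map_sum, sub_eq_zero, ← hfix w]
  refine Finset.sum_congr rfl fun w' _ => ?_
  rw [rightDerivs_mul_of_constant v q ((mem_rightConstants v q).1 (hconst w')).2, hval,
    Algebra.smul_def, Algebra.commutes]

/-- Descent on the length of the composites that kill x, one correction per step, down to length 0,
where x itself is zero. -/
theorem mem_iSup_rightConstants_mul {n j : ℕ} (hj : j + 1 ≤ n) {x : TensorAlgebra K V}
    (hx : x ∈ degreePart K V n) (h : ∀ u : List (Fin N), u.length = j → rightDerivs v q u x = 0) :
    x ∈ ⨆ d ∈ Set.Icc 2 n, rightConstants v q d * degreePart K V (n - d) := by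
  induction j generalizing x with
  | zero =>
    have : x = 0 := h [] rfl
    rw [this]
    exact zero_mem _
  | succ j ih =>
    obtain ⟨d, rfl⟩ : ∃ d, n = d + j := ⟨n - j, by omega⟩
    obtain ⟨z, hz, hxz⟩ := exists_sub_rightDerivs_eq_zero v q hx h
    rw [← sub_add_cancel x z]
    have hzn : z ∈ degreePart K V (d + j) := by
      have hle : rightConstants v q d * degreePart K V j ≤ degreePart K V (d + j) :=
        Submodule.mul_le.2 fun k hk b hb =>
          mul_mem_degreePart ((mem_rightConstants v q).1 hk).1 hb
      exact hle hz
    refine add_mem (ih (by omega) (sub_mem hx hzn) hxz) ?_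
    -- The constants used have degree d = n - j, and j + 2 ≤ n here, so d ≥ 2.
    refine Submodule.mem_iSup_of_mem d (Submodule.mem_iSup_of_mem ⟨by omega, by omega⟩ ?_)
    rwa [Nat.add_sub_cancel_left]

/-- The radical is generated, already as a right ideal, by the right constants. -/
theorem radical_inf_degreePart_le {n : ℕ} (hn : 1 ≤ n) :
    radical v q ⊓ degreePart K V n ≤
      ⨆ d ∈ Set.Icc 2 n, rightConstants v q d * degreePart K V (n - d) := by
  rintro x ⟨hx, hxn⟩
  obtain ⟨n, rfl⟩ : ∃ m, n = m + 1 := ⟨n - 1, by omega⟩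
  -- Composites of length n - 1, in terms of the original n, already vanish: they land in degree 1,
  -- where the functionals φ_i are coordinates.
  refine mem_iSup_rightConstants_mul v q le_rfl hxn fun u hu => ?_
  have hdeg : rightDerivs v q u x ∈ degreePart K V 1 :=
    rightDerivs_mem_degreePart v q u (by rwa [hu, add_comm])
  have hzero : ∀ i, pairingGen v i (rightDerivs v q u x) = 0 := by
    intro i
    rw [← counit_rightDeriv v q, ← rightDerivs_cons]
    exact (mem_radical v q).1 hx _
  have hlin : ∀ y ∈ degreePart K V 1, y = ∑ i, pairingGen v i y • gen v i := by
    intro y hy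
    have : degreePart K V 1 ≤ LinearMap.eqLocus LinearMap.id
        (∑ i, (pairingGen v i).smulRight (gen v i)) := by
      refine degreePart_le_of_monom v fun l hl => ?_
      obtain ⟨k, rfl⟩ := List.length_eq_one_iff.1 hl
      have hk : ∀ i, pairingGen v i (gen v k) = if k = i then 1 else 0 := fun i => by
        simpa using pairingGen_gen_mul v i k 1
      simp [hk]
    simpa using this hy
  rw [hlin _ hdeg]
  simp [hzero]

end Decomposition

/-! ### Reversal of words, exchanging left and right. -/

section Reversal

variable (K V) in
/-- The anti-automorphism of `T(V)` that reverses monomials. -/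
noncomputable def rev : TensorAlgebra K V →ₗ[K] TensorAlgebra K V :=
  (MulOpposite.opLinearEquiv K).symm.toLinearMap ∘ₗ
    (TensorAlgebra.lift K
      ((MulOpposite.opLinearEquiv K).toLinearMap ∘ₗ TensorAlgebra.ι K :
        V →ₗ[K] (TensorAlgebra K V)ᵐᵒᵖ)).toLinearMap

@[simp]
theorem rev_one : rev K V 1 = 1 := by simp [rev]

@[simp]
theorem rev_mul (x y : TensorAlgebra K V) : rev K V (x * y) = rev K V y * rev K V x := by
  simp [rev]

variable (v : Basis (Fin N) K V) (q : Fin N → Fin N → Kˣ)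

@[simp]
theorem rev_gen (i : Fin N) : rev K V (gen v i) = gen v i := by simp [rev, gen]

theorem rev_monom (l : List (Fin N)) : rev K V (monom v l) = monom v l.reverse := by
  induction l with
  | nil => simp
  | cons i l ih => simp [ih, monom_append]

theorem rev_rev (v : Basis (Fin N) K V) (x : TensorAlgebra K V) : rev K V (rev K V x) = x := by
  have : rev K V ∘ₗ rev K V = LinearMap.id :=
    linearMap_ext_monom v fun l => by simp [rev_monom]
  exact LinearMap.congr_fun this x

theorem counit_rev (v : Basis (Fin N) K V) (x : TensorAlgebra K V) :
    counit K V (rev K V x) = counit K V x := by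
  have : (counit K V).toLinearMap ∘ₗ rev K V = (counit K V).toLinearMap :=
    linearMap_ext_gen_mul v (by simp) fun k x _ => by simp
  exact LinearMap.congr_fun this x

theorem rev_mem_degreePart (v : Basis (Fin N) K V) {m : ℕ} {x : TensorAlgebra K V}
    (hx : x ∈ degreePart K V m) : rev K V x ∈ degreePart K V m := by
  refine degreePart_le_of_monom v (S := (degreePart K V m).comap (rev K V)) ?_ hx
  rintro l rfl
  rw [Submodule.mem_comap, rev_monom, ← List.length_reverse]
  exact monom_mem_degreePart v _

/-- Reversal turns the last-letter rule for ∂^L into the first-letter rule for ∂^R, with the indices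
of q exchanged in the rescaling. -/
theorem leftDeriv_rev (i : Fin N) (x : TensorAlgebra K V) :
    leftDeriv v q i (rev K V x) = rev K V (rightDeriv v (fun a b => q b a) i x) := by
  have hs : ∀ (c : Fin N → K) x, scale v c (rev K V x) = rev K V (scale v c x) := by
    intro c x
    have : (scale v c).toLinearMap ∘ₗ rev K V = rev K V ∘ₗ (scale v c).toLinearMap :=
      linearMap_ext_monom v fun l => by
        simp [rev_monom, scale_monom, List.prod_reverse]
    exact LinearMap.congr_fun this x
  have : leftDeriv v q i ∘ₗ rev K V = rev K V ∘ₗ rightDeriv v (fun a b => q b a) i := by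
    refine linearMap_ext_gen_mul v (by simp) fun k x h => ?_
    simp only [LinearMap.comp_apply] at h ⊢
    rw [rev_mul, rev_gen, leftDeriv_mul_gen, h, rightDeriv_gen_mul, map_add, rev_mul, rev_gen,
      map_smul, twist, hs]
    by_cases hk : k = i
    · subst hk; rfl
    · simp [hk]
  exact LinearMap.congr_fun this x

theorem rev_mem_radical {x : TensorAlgebra K V} (hx : x ∈ radical v (fun a b => q b a)) :
    rev K V x ∈ radical v q := by
  rw [mem_radical]
  intro u
  rw [← counit_leftDerivs]
  induction u generalizing x with
  | nil => rw [leftDerivs_nil, counit_rev v]; exact (mem_radical v _).1 hx []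
  | cons i u ih =>
    rw [leftDerivs_cons, leftDeriv_rev]
    exact ih (((mem_radical_iff_rightDeriv v _).1 hx).2 i)

end Reversal

/-! ### T_n and U_n expressed by derivations. -/

section TensorPowers

/-- The basis tensor `v_{w 0} ⊗ ⋯ ⊗ v_{w (n-1)}`. -/
noncomputable def wordTensor (v : Basis (Fin N) K V) {n : ℕ} (w : Fin n → Fin N) : ⨂[K]^n V :=
  PiTensorProduct.tprod K fun k => v (w k)

variable (v : Basis (Fin N) K V) (q : Fin N → Fin N → Kˣ)

theorem piTensorProduct_apply_eq_wordTensor {n : ℕ} (w : Fin n → Fin N) :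
    Basis.piTensorProduct (fun _ : Fin n => v) w = wordTensor v w :=
  Basis.piTensorProduct_apply _ _

theorem linearMap_ext_wordTensor {n : ℕ} {M : Type*} [AddCommGroup M] [Module K M]
    {f g : (⨂[K]^n V) →ₗ[K] M} (h : ∀ w : Fin n → Fin N, f (wordTensor v w) = g (wordTensor v w)) :
    f = g :=
  (Basis.piTensorProduct fun _ : Fin n => v).ext fun w => by
    rw [piTensorProduct_apply_eq_wordTensor]; exact h w

theorem toTensorAlgebra_wordTensor {n : ℕ} (w : Fin n → Fin N) :
    TensorPower.toTensorAlgebra (wordTensor v w) = monom v (List.ofFn w) := by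
  rw [wordTensor, TensorPower.toTensorAlgebra_tprod, TensorAlgebra.tprod_apply, monom,
    List.map_ofFn]
  rfl

theorem toTensorAlgebra_injective (n : ℕ) :
    Function.Injective (TensorPower.toTensorAlgebra : (⨂[K]^n V) →ₗ[K] TensorAlgebra K V) := by
  have h : ∀ x : ⨂[K]^n V, TensorAlgebra.toDirectSum (TensorPower.toTensorAlgebra x) =
      DirectSum.of (fun n => ⨂[K]^n V) n x := by
    intro x
    rw [← TensorAlgebra.toDirectSum_ofDirectSum (DirectSum.of (fun n => ⨂[K]^n V) n x)]
    congr 1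
    exact (DirectSum.toAddMonoid_of
      (fun _ ↦ LinearMap.toAddMonoidHom TensorPower.toTensorAlgebra) _ _).symm
  intro x y hxy
  exact DirectSum.of_injective (β := fun n => ⨂[K]^n V) n (by rw [← h, ← h, hxy])

theorem range_toTensorAlgebra (v : Basis (Fin N) K V) (n : ℕ) :
    LinearMap.range (TensorPower.toTensorAlgebra : (⨂[K]^n V) →ₗ[K] TensorAlgebra K V) =
      degreePart K V n := by
  apply le_antisymm
  · rw [LinearMap.range_eq_map, ← (Basis.piTensorProduct fun _ : Fin n => v).span_eq,
      Submodule.map_span_le]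
    rintro _ ⟨w, rfl⟩
    rw [piTensorProduct_apply_eq_wordTensor, toTensorAlgebra_wordTensor]
    simpa using monom_mem_degreePart v (List.ofFn w)
  · refine degreePart_le_of_monom v ?_
    rintro l rfl
    exact ⟨wordTensor v l.get, by rw [toTensorAlgebra_wordTensor, List.ofFn_get]⟩

theorem braidGen_wordTensor {n : ℕ} (i : Fin (n - 1)) (w : Fin n → Fin N) :
    braidGen v q n i (wordTensor v w) =
      (q (w ⟨i, by omega⟩) (w ⟨i + 1, by omega⟩) : K) • wordTensor v (w ∘ adjSwap n i) := by
  rw [← piTensorProduct_apply_eq_wordTensor, braidGen, Basis.constr_basis]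
  rfl

theorem braidWord_nil {n : ℕ} : braidWord v q n [] = 1 := rfl

theorem braidWord_cons {n : ℕ} (i : Fin (n - 1)) (l : List (Fin (n - 1))) :
    braidWord v q n (i :: l) = braidGen v q n i * braidWord v q n l := by
  simp [braidWord]

theorem braidWord_append {n : ℕ} (l l' : List (Fin (n - 1))) :
    braidWord v q n (l ++ l') = braidWord v q n l * braidWord v q n l' := by
  simp [braidWord]

theorem ofFn_comp_adjSwap {α : Type*} {n : ℕ} {w : Fin n → α} {a b : List α} {x y : α}
    (hw : List.ofFn w = a ++ x :: y :: b) (i : Fin (n - 1)) (hi : (i : ℕ) = a.length) :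
    List.ofFn (w ∘ adjSwap n i) = a ++ y :: x :: b ∧ w ⟨i, by omega⟩ = x ∧
      w ⟨i + 1, by omega⟩ = y := by
  have hlen : n = a.length + (b.length + 2) := by simpa using congrArg List.length hw
  have hget : ∀ (k : ℕ) (hk : k < n), w ⟨k, hk⟩ = (a ++ x :: y :: b)[k]'(by simp; omega) := by
    intro k hk
    simp [← hw]
  have hx : w ⟨i, by omega⟩ = x := by rw [hget]; simp [hi]
  have hy : w ⟨i + 1, by omega⟩ = y := by rw [hget]; simp [hi]
  refine ⟨List.ext_getElem (by simp; omega) fun k hk hk' => ?_, hx, hy⟩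
  have hkn : k < n := by simpa using hk
  simp only [List.getElem_ofFn, Function.comp_apply, adjSwap]
  by_cases h1 : k = i
  · have : (⟨k, hkn⟩ : Fin n) = ⟨i, by omega⟩ := Fin.ext h1
    rw [this, Equiv.swap_apply_left, hy]
    simp [h1, hi]
  by_cases h2 : k = i + 1
  · have : (⟨k, hkn⟩ : Fin n) = ⟨i + 1, by omega⟩ := Fin.ext h2
    rw [this, Equiv.swap_apply_right, hx]
    simp [h2, hi]
  · rw [Equiv.swap_apply_of_ne_of_ne (by simpa [Fin.ext_iff] using h1)
      (by simpa [Fin.ext_iff] using h2), hget]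
    rcases lt_or_ge k a.length with h | h
    · simp [List.getElem_append_left h]
    · obtain ⟨m, rfl⟩ : ∃ m, k = a.length + (m + 2) := ⟨k - a.length - 2, by omega⟩
      simp

/-- Braiding a letter to the right end of a word. -/
theorem braidWord_moveRight {n : ℕ} {w : Fin n → Fin N} {a b : List (Fin N)} {x : Fin N}
    (hw : List.ofFn w = a ++ x :: b) :
    TensorPower.toTensorAlgebra (braidWord v q n ((List.finRange (n - 1)).reverse.take b.length)
      (wordTensor v w)) = (b.map fun y => (q x y : K)).prod • monom v (a ++ b ++ [x]) := by
  induction b generalizing a w with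
  | nil => simp [braidWord_nil, toTensorAlgebra_wordTensor, hw]
  | cons y b ih =>
    have hlen : n = a.length + (b.length + 2) := by simpa using congrArg List.length hw
    let i : Fin (n - 1) := ⟨a.length, by omega⟩
    have hi : (List.finRange (n - 1)).reverse.take (b.length + 1) =
        (List.finRange (n - 1)).reverse.take b.length ++ [i] := by
      rw [List.take_add_one, List.getElem?_eq_getElem (by simp; omega)]
      simp [i, Fin.ext_iff]
      omega
    obtain ⟨h1, h2, h3⟩ := ofFn_comp_adjSwap hw i rfl
    rw [List.length_cons, hi, braidWord_append, Module.End.mul_apply, braidWord_cons, braidWord_nil,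
      mul_one, braidGen_wordTensor, map_smul, map_smul, h2, h3,
      ih (a := a ++ [y]) (by simpa using h1)]
    simp [mul_smul]

/-- Braiding a letter to the left end of a word. -/
theorem braidWord_moveLeft {n : ℕ} {w : Fin n → Fin N} {a b : List (Fin N)} {x : Fin N}
    (hw : List.ofFn w = a ++ x :: b) :
    TensorPower.toTensorAlgebra (braidWord v q n ((List.finRange (n - 1)).take a.length)
      (wordTensor v w)) = (a.map fun y => (q y x : K)).prod • monom v (x :: a ++ b) := by
  induction a using List.reverseRecOn generalizing b w with
  | nil => simp [braidWord_nil, toTensorAlgebra_wordTensor, hw]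
  | append_singleton a y ih =>
    have hlen : n = a.length + (b.length + 2) := by
      have := congrArg List.length hw
      simp at this
      omega
    let i : Fin (n - 1) := ⟨a.length, by omega⟩
    have hi : (List.finRange (n - 1)).take (a.length + 1) =
        (List.finRange (n - 1)).take a.length ++ [i] := by
      rw [List.take_add_one, List.getElem?_eq_getElem (by simp; omega)]
      simp [i]
    obtain ⟨h1, h2, h3⟩ := ofFn_comp_adjSwap (a := a) (x := y) (y := x) (b := b)
      (by simpa using hw) i rfl
    rw [List.length_append, List.length_singleton, hi, braidWord_append, Module.End.mul_apply,
      braidWord_cons, braidWord_nil, mul_one, braidGen_wordTensor, map_smul, map_smul, h2, h3,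
      ih h1]
    simp [smul_smul, mul_comm]

/-- The k-th summand of T_n braids the letter with k letters after it to the right end; ∂_i^R
collects the same terms, with that letter removed. -/
theorem toTensorAlgebra_rightDiffElement {n : ℕ} (x : ⨂[K]^n V) :
    TensorPower.toTensorAlgebra (rightDiffElement v q n x) =
      ∑ i, rightDeriv v q i (TensorPower.toTensorAlgebra x) * gen v i := by
  -- The untouched prefix a is carried along so that the induction can peel letters off l while n
  -- and w stay fixed.
  have key : ∀ (l a : List (Fin N)) (w : Fin n → Fin N), List.ofFn w = a ++ l →
      ∑ k ∈ Finset.range l.length, TensorPower.toTensorAlgebra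
        (braidWord v q n ((List.finRange (n - 1)).reverse.take k) (wordTensor v w)) =
      ∑ i, monom v a * rightDeriv v q i (monom v l) * gen v i := by
    intro l
    induction l with
    | nil => simp
    | cons x l ih =>
      intro a w hw
      rw [List.length_cons, Finset.sum_range_succ, ih (a ++ [x]) w (by simpa using hw),
        braidWord_moveRight v q hw]
      simp only [monom_cons, rightDeriv_gen_mul, mul_add, add_mul, Finset.sum_add_distrib,
        monom_append, monom_nil, mul_one, twist_monom]
      congr 1
      · simp only [mul_assoc]
      · simp [mul_assoc]
  have : TensorPower.toTensorAlgebra ∘ₗ rightDiffElement v q n =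
      ∑ i, LinearMap.mulRight K (gen v i) ∘ₗ rightDeriv v q i ∘ₗ TensorPower.toTensorAlgebra :=
    linearMap_ext_wordTensor v fun w => by
      have := key (List.ofFn w) [] w rfl
      simpa [rightDiffElement, toTensorAlgebra_wordTensor] using this
  simpa using LinearMap.congr_fun this x

theorem toTensorAlgebra_leftDiffElement {n : ℕ} (x : ⨂[K]^n V) :
    TensorPower.toTensorAlgebra (leftDiffElement v q n x) =
      ∑ i, gen v i * leftDeriv v q i (TensorPower.toTensorAlgebra x) := by
  have key : ∀ (l b : List (Fin N)) (w : Fin n → Fin N), List.ofFn w = l ++ b →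
      ∑ k ∈ Finset.range l.length, TensorPower.toTensorAlgebra
        (braidWord v q n ((List.finRange (n - 1)).take k) (wordTensor v w)) =
      ∑ i, gen v i * leftDeriv v q i (monom v l) * monom v b := by
    intro l
    induction l using List.reverseRecOn with
    | nil => simp
    | append_singleton l x ih =>
      intro b w hw
      have hw' : List.ofFn w = l ++ x :: b := by simpa using hw
      rw [List.length_append, List.length_singleton, Finset.sum_range_succ, ih (x :: b) w hw',
        braidWord_moveLeft v q hw']
      simp only [monom_cons, leftDeriv_mul_gen, mul_add, add_mul, Finset.sum_add_distrib,
        monom_append, monom_nil, mul_one, scale_monom]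
      congr 1
      · simp only [mul_assoc]
      · simp [mul_assoc]
  have : TensorPower.toTensorAlgebra ∘ₗ leftDiffElement v q n =
      ∑ i, LinearMap.mulLeft K (gen v i) ∘ₗ leftDeriv v q i ∘ₗ TensorPower.toTensorAlgebra :=
    linearMap_ext_wordTensor v fun w => by
      have := key (List.ofFn w) [] w (by simp)
      simpa [leftDiffElement, toTensorAlgebra_wordTensor] using this
  simpa using LinearMap.congr_fun this x

theorem sum_mul_gen_eq_zero_iff {y : Fin N → TensorAlgebra K V} :
    ∑ i, y i * gen v i = 0 ↔ ∀ i, y i = 0 := by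
  refine ⟨fun h j => ?_, fun h => by simp [h]⟩
  -- D strips a final letter v_j and kills all other words, isolating y j.
  let D : TensorAlgebra K V →ₗ[K] TensorAlgebra K V := v.tensorAlgebra.constr K fun a =>
    if a.toList.getLast? = some j then monom v a.toList.dropLast else 0
  have hD : ∀ i z, D (z * gen v i) = if i = j then z else 0 := by
    intro i z
    have : D ∘ₗ LinearMap.mulRight K (gen v i) = if i = j then LinearMap.id else 0 := by
      refine linearMap_ext_monom v fun l => ?_
      have : monom v l * gen v i = v.tensorAlgebra (FreeMonoid.ofList (l ++ [i])) := by
        rw [tensorAlgebra_ofList, monom_append]; simp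
      rw [LinearMap.comp_apply, LinearMap.mulRight_apply, this, Basis.constr_basis]
      by_cases h : i = j <;> simp [h]
    have := LinearMap.congr_fun this z
    by_cases h : i = j <;> simpa [h] using this
  have := congrArg D h
  simpa [hD] using this

theorem sum_gen_mul_eq_zero_iff {y : Fin N → TensorAlgebra K V} :
    ∑ i, gen v i * y i = 0 ↔ ∀ i, y i = 0 := by
  refine ⟨fun h j => ?_, fun h => by simp [h]⟩
  have h1 := congrArg (rev K V) h
  simp only [map_sum, rev_mul, rev_gen, map_zero] at h1
  rw [← rev_rev v (y j), (sum_mul_gen_eq_zero_iff v).1 h1 j, map_zero]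

theorem rightDiffElement_eq_zero_iff {n : ℕ} (x : ⨂[K]^n V) :
    rightDiffElement v q n x = 0 ↔
      ∀ i, rightDeriv v q i (TensorPower.toTensorAlgebra x) = 0 := by
  rw [← map_eq_zero_iff _ (toTensorAlgebra_injective (K := K) (V := V) n),
    toTensorAlgebra_rightDiffElement, sum_mul_gen_eq_zero_iff]

theorem leftDiffElement_eq_zero_iff {n : ℕ} (x : ⨂[K]^n V) :
    leftDiffElement v q n x = 0 ↔
      ∀ i, leftDeriv v q i (TensorPower.toTensorAlgebra x) = 0 := by
  rw [← map_eq_zero_iff _ (toTensorAlgebra_injective (K := K) (V := V) n),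
    toTensorAlgebra_leftDiffElement, sum_gen_mul_eq_zero_iff]

theorem mem_rightConst {n : ℕ} {x : TensorAlgebra K V} :
    x ∈ rightConst v q n ↔ x ∈ degreePart K V n ∧ ∀ i, rightDeriv v q i x = 0 := by
  rw [← range_toTensorAlgebra v]
  constructor
  · rintro ⟨y, hy, rfl⟩
    exact ⟨⟨y, rfl⟩, (rightDiffElement_eq_zero_iff v q y).1 hy⟩
  · rintro ⟨⟨y, rfl⟩, hy⟩
    exact ⟨y, (rightDiffElement_eq_zero_iff v q y).2 hy, rfl⟩

theorem mem_leftConst {n : ℕ} {x : TensorAlgebra K V} :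
    x ∈ leftConst v q n ↔ x ∈ degreePart K V n ∧ ∀ i, leftDeriv v q i x = 0 := by
  rw [← range_toTensorAlgebra v]
  constructor
  · rintro ⟨y, hy, rfl⟩
    exact ⟨⟨y, rfl⟩, (leftDiffElement_eq_zero_iff v q y).1 hy⟩
  · rintro ⟨⟨y, rfl⟩, hy⟩
    exact ⟨y, (leftDiffElement_eq_zero_iff v q y).2 hy, rfl⟩

end TensorPowers

/-! ### Both ideals of constants agree with the radical in positive degree. -/

section Ideals

variable (v : Basis (Fin N) K V) (q : Fin N → Fin N → Kˣ)

theorem rightPart_eq {m : ℕ} (hm : 1 ≤ m) :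
    rightPart v q m = radical v q ⊓ degreePart K V m := by
  apply le_antisymm
  · refine inf_le_inf_right _ (idealSpan_le_radical v q ?_)
    rw [rightConstLE, SetLike.coe_subset_coe, Submodule.span_le]
    refine Set.iUnion₂_subset fun n hn x hx => ?_
    obtain ⟨hx, hx'⟩ := (mem_rightConst v q).1 hx
    obtain ⟨k, rfl⟩ : ∃ k, n = k + 1 := ⟨n - 1, by have := hn.1; omega⟩
    refine (mem_radical_iff_rightDeriv v q).2
      ⟨counit_eq_zero_of_mem_degreePart v hx, fun i => ?_⟩
    rw [hx']
    exact zero_mem _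
  · refine le_inf ((radical_inf_degreePart_le v q hm).trans ?_) inf_le_right
    refine iSup₂_le fun d hd => Submodule.mul_le.2 fun k hk b _ => ?_
    refine TwoSidedIdeal.mul_mem_right _ _ _ (TwoSidedIdeal.subset_span ?_)
    exact Submodule.subset_span (Set.mem_biUnion hd
      ((mem_rightConst v q).2 ((mem_rightConstants v q).1 hk)))

theorem leftPart_eq {m : ℕ} (hm : 1 ≤ m) :
    leftPart v q m = radical v q ⊓ degreePart K V m := by
  apply le_antisymm
  · refine inf_le_inf_right _ (idealSpan_le_radical v q ?_)
    rw [leftConstLE, SetLike.coe_subset_coe, Submodule.span_le]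
    refine Set.iUnion₂_subset fun n hn x hx => ?_
    obtain ⟨hx, hx'⟩ := (mem_leftConst v q).1 hx
    obtain ⟨k, rfl⟩ : ∃ k, n = k + 1 := ⟨n - 1, by have := hn.1; omega⟩
    refine (mem_radical_iff_leftDeriv v q).2
      ⟨counit_eq_zero_of_mem_degreePart v hx, fun i => ?_⟩
    rw [hx']
    exact zero_mem _
  · refine le_inf (fun x hx => ?_) inf_le_right
    -- The decomposition for the transposed matrix, read backwards: right constants become left
    -- constants and stand as right factors.
    have hle : radical v (fun a b => q b a) ⊓ degreePart K V m ≤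
        (idealSpan (leftConstLE v q m : Set (TensorAlgebra K V))).comap (rev K V) := by
      refine (radical_inf_degreePart_le v _ hm).trans ?_
      refine iSup₂_le fun d hd => Submodule.mul_le.2 fun k hk b _ => ?_
      obtain ⟨hk, hk'⟩ := (mem_rightConstants v _).1 hk
      rw [Submodule.mem_comap, rev_mul]
      refine TwoSidedIdeal.mul_mem_left _ _ _ (TwoSidedIdeal.subset_span ?_)
      refine Submodule.subset_span (Set.mem_biUnion hd ((mem_leftConst v q).2
        ⟨rev_mem_degreePart v hk, fun i => ?_⟩))
      rw [leftDeriv_rev, hk', map_zero]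
    have := hle ⟨rev_mem_radical v (fun a b => q b a) hx.1, rev_mem_degreePart v hx.2⟩
    rwa [Submodule.mem_comap, rev_rev v] at this

end Ideals

/-! ### Length of a permutation as its number of inversions. -/

section Inversions

variable {n : ℕ}

/-- The inversions of a permutation. -/
def inversions (τ : Equiv.Perm (Fin n)) : Finset (Fin n × Fin n) :=
  Finset.univ.filter fun p => p.1 < p.2 ∧ τ p.2 < τ p.1

theorem mem_inversions {τ : Equiv.Perm (Fin n)} {p : Fin n × Fin n} :
    p ∈ inversions τ ↔ p.1 < p.2 ∧ τ p.2 < τ p.1 := by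
  simp [inversions]

theorem val_adjSwap (i : Fin (n - 1)) (x : Fin n) :
    (adjSwap n i x : ℕ) = if (x : ℕ) = i then (i : ℕ) + 1 else if (x : ℕ) = i + 1 then (i : ℕ)
      else x := by
  rw [adjSwap, Equiv.swap_apply_def]
  simp only [Fin.ext_iff]
  split_ifs <;> rfl

theorem adjSwap_mul_self (i : Fin (n - 1)) : adjSwap n i * adjSwap n i = 1 :=
  Equiv.swap_mul_self _ _

theorem adjSwap_inv (i : Fin (n - 1)) : (adjSwap n i)⁻¹ = adjSwap n i :=
  Equiv.swap_inv _ _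

/-- Only the values i and i + 1 are exchanged, and being adjacent they compare identically with any
third value; hence only the pair (a, b) changes order. -/
theorem inversions_adjSwap_mul {i : Fin (n - 1)} {τ : Equiv.Perm (Fin n)} {a b : Fin n}
    (hab : a < b) (ha : (τ a : ℕ) = i) (hb : (τ b : ℕ) = i + 1) :
    inversions (adjSwap n i * τ) = insert (a, b) (inversions τ) ∧ (a, b) ∉ inversions τ := by
  constructor
  · ext ⟨c, d⟩
    simp only [mem_inversions, Finset.mem_insert, Equiv.Perm.mul_apply, Fin.lt_def, val_adjSwap,
      Prod.mk.injEq]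
    have hc1 : (τ c : ℕ) = i ↔ c = a := by
      rw [← ha, ← Fin.ext_iff, τ.injective.eq_iff]
    have hc2 : (τ c : ℕ) = i + 1 ↔ c = b := by
      rw [← hb, ← Fin.ext_iff, τ.injective.eq_iff]
    have hd1 : (τ d : ℕ) = i ↔ d = a := by
      rw [← ha, ← Fin.ext_iff, τ.injective.eq_iff]
    have hd2 : (τ d : ℕ) = i + 1 ↔ d = b := by
      rw [← hb, ← Fin.ext_iff, τ.injective.eq_iff]
    rw [Fin.lt_def] at hab
    rw [Fin.ext_iff] at hc1 hc2 hd1 hd2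
    rw [Fin.ext_iff, Fin.ext_iff]
    split_ifs <;> omega
  · rw [mem_inversions, Fin.lt_def, Fin.lt_def]
    simp only
    omega

/-- Multiplying on the left by an adjacent transposition adds or removes one inversion. -/
theorem inversions_adjSwap_mul_cases (i : Fin (n - 1)) (τ : Equiv.Perm (Fin n)) :
    (∃ a b, a < b ∧ (τ a : ℕ) = i ∧ (τ b : ℕ) = i + 1 ∧
      (inversions (adjSwap n i * τ)).card = (inversions τ).card + 1) ∨
    (∃ a b, b < a ∧ (τ a : ℕ) = i ∧ (τ b : ℕ) = i + 1 ∧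
      (inversions τ).card = (inversions (adjSwap n i * τ)).card + 1) := by
  obtain ⟨a, ha⟩ := τ.surjective ⟨i, by omega⟩
  obtain ⟨b, hb⟩ := τ.surjective ⟨i + 1, by omega⟩
  have ha' : (τ a : ℕ) = i := by rw [ha]
  have hb' : (τ b : ℕ) = i + 1 := by rw [hb]
  have hne : a ≠ b := by rintro rfl; omega
  rcases lt_or_gt_of_ne hne with h | h
  · obtain ⟨h1, h2⟩ := inversions_adjSwap_mul h ha' hb'
    exact Or.inl ⟨a, b, h, ha', hb', by rw [h1, Finset.card_insert_of_notMem h2]⟩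
  · obtain ⟨h1, h2⟩ := inversions_adjSwap_mul (i := i) (τ := adjSwap n i * τ) h
      (by rw [Equiv.Perm.mul_apply, val_adjSwap]; simp [hb'])
      (by rw [Equiv.Perm.mul_apply, val_adjSwap]; simp [ha'])
    rw [← mul_assoc, adjSwap_mul_self, one_mul] at h1
    exact Or.inr ⟨a, b, h, ha', hb', by rw [h1, Finset.card_insert_of_notMem h2]⟩

theorem inversions_one : inversions (1 : Equiv.Perm (Fin n)) = ∅ := by
  ext p
  simp only [mem_inversions, Equiv.Perm.one_apply, Finset.notMem_empty, iff_false, not_and, not_lt]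
  exact fun h => h.le

theorem card_inversions_le (l : List (Fin (n - 1))) :
    (inversions (l.map (adjSwap n)).prod).card ≤ l.length := by
  induction l with
  | nil => simp [inversions_one]
  | cons i l ih =>
    rw [List.map_cons, List.prod_cons, List.length_cons]
    rcases inversions_adjSwap_mul_cases i (l.map (adjSwap n)).prod with
      ⟨_, _, _, _, _, h⟩ | ⟨_, _, _, _, _, h⟩ <;> omega

/-- The hypothesis says that τ⁻¹ increases on consecutive values, and a strictly increasing
permutation of a finite chain is trivial. -/
theorem eq_one_of_forall_lt {τ : Equiv.Perm (Fin n)}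
    (h : ∀ (i : Fin (n - 1)) (a b : Fin n), (τ a : ℕ) = i → (τ b : ℕ) = i + 1 → a < b) : τ = 1 := by
  have hmono : StrictMono (τ⁻¹ : Equiv.Perm (Fin n)) := by
    cases n with
    | zero => exact fun a => a.elim0
    | succ n =>
      refine Fin.strictMono_iff_lt_succ.2 fun i => h i _ _ ?_ ?_ <;> simp
  rw [← inv_eq_one]
  exact DFunLike.coe_injective ((StrictMono.range_inj hmono strictMono_id).1
    (by rw [(τ⁻¹).surjective.range_eq, Set.range_id]))

theorem exists_list_length_eq_card_inversions (τ : Equiv.Perm (Fin n)) :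
    ∃ l : List (Fin (n - 1)), (l.map (adjSwap n)).prod = τ ∧ l.length = (inversions τ).card := by
  induction h : (inversions τ).card using Nat.strong_induction_on generalizing τ with
  | _ k ih =>
    by_cases hτ : τ = 1
    · subst hτ
      exact ⟨[], rfl, by rw [← h, inversions_one]; rfl⟩
    · have : ∃ i : Fin (n - 1), (inversions τ).card = (inversions (adjSwap n i * τ)).card + 1 := by
        by_contra! hcon
        refine hτ (eq_one_of_forall_lt fun i a b ha hb => ?_)
        rcases inversions_adjSwap_mul_cases i τ with ⟨a', b', hab, ha', hb', _⟩ | ⟨_, _, _, _, _, h'⟩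
        · rwa [τ.injective (Fin.ext (ha.trans ha'.symm)), τ.injective (Fin.ext (hb.trans hb'.symm))]
        · exact absurd h' (hcon i)
      obtain ⟨i, hi⟩ := this
      obtain ⟨l, hl, hlen⟩ := ih _ (by omega) (adjSwap n i * τ) rfl
      refine ⟨i :: l, ?_, by rw [List.length_cons]; omega⟩
      rw [List.map_cons, List.prod_cons, hl, ← mul_assoc, adjSwap_mul_self, one_mul]

theorem IsReducedExpr.length_eq {l : List (Fin (n - 1))} {τ : Equiv.Perm (Fin n)}
    (h : IsReducedExpr l τ) : l.length = (inversions τ).card := by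
  obtain ⟨l', hl', hlen⟩ := exists_list_length_eq_card_inversions τ
  refine le_antisymm (hlen ▸ h.2 l' hl') ?_
  rw [← h.1]
  exact card_inversions_le l

end Inversions

/-! ### The symmetrizer on words and its recursion. -/

section Symmetrizer

variable (v : Basis (Fin N) K V) (q : Fin N → Fin N → Kˣ)

/-- The coefficient with which the lift of `τ` permutes the basis tensor of the word `w`. -/
def permCoeff {n : ℕ} (τ : Equiv.Perm (Fin n)) (w : Fin n → Fin N) : K :=
  ∏ p ∈ inversions τ, (q (w p.1) (w p.2) : K)

/-- In a reduced word each generator creates exactly one new inversion (a, b) and contributes the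
scalar for the letters originally at a and b. The result depends only on τ, so the chosen reduced
expressions are immaterial. -/
theorem braidWord_wordTensor {n : ℕ} {l : List (Fin (n - 1))} {τ : Equiv.Perm (Fin n)}
    (h : (l.map (adjSwap n)).prod = τ) (hl : l.length = (inversions τ).card) (w : Fin n → Fin N) :
    braidWord v q n l (wordTensor v w) =
      permCoeff q τ w • wordTensor v (w ∘ (τ⁻¹ : Equiv.Perm (Fin n))) := by
  induction l generalizing τ with
  | nil =>
    obtain rfl : 1 = τ := h
    simp [braidWord_nil, permCoeff, inversions_one]
  | cons i l ih =>
    rw [List.map_cons, List.prod_cons] at h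
    rw [List.length_cons] at hl
    obtain ⟨ρ, hρ⟩ : ∃ ρ, (l.map (adjSwap n)).prod = ρ := ⟨_, rfl⟩
    rw [hρ] at h
    have hle := card_inversions_le l
    rw [hρ] at hle
    subst h
    -- If the first generator removed an inversion, ρ would have more inversions than the tail has
    -- letters.
    rcases inversions_adjSwap_mul_cases i ρ with ⟨a, b, hab, ha, hb, hc⟩ | ⟨_, _, _, _, _, hc⟩
    swap
    · omega
    obtain ⟨h1, h2⟩ := inversions_adjSwap_mul hab ha hb
    rw [braidWord_cons, Module.End.mul_apply, ih hρ (by omega), map_smul, braidGen_wordTensor,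
      permCoeff, permCoeff, h1, Finset.prod_insert h2, smul_smul, mul_comm]
    have ha' : (ρ⁻¹ : Equiv.Perm (Fin n)) ⟨i, by omega⟩ = a := by
      rw [Equiv.Perm.inv_eq_iff_eq]; exact Fin.ext ha.symm
    have hb' : (ρ⁻¹ : Equiv.Perm (Fin n)) ⟨i + 1, by omega⟩ = b := by
      rw [Equiv.Perm.inv_eq_iff_eq]; exact Fin.ext hb.symm
    rw [Function.comp_apply, Function.comp_apply, ha', hb', mul_inv_rev, adjSwap_inv]
    rfl

theorem symmetrizer_wordTensor {n : ℕ} (w : Fin n → Fin N) :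
    symmetrizer v q n (wordTensor v w) =
      ∑ τ : Equiv.Perm (Fin n),
        permCoeff q τ w • wordTensor v (w ∘ (τ⁻¹ : Equiv.Perm (Fin n))) := by
  rw [symmetrizer, LinearMap.sum_apply]
  exact Finset.sum_congr rfl fun τ _ =>
    braidWord_wordTensor v q (reducedExpr_spec τ).1 (reducedExpr_spec τ).length_eq w

/-- The permutation that moves `k` to the end and acts on the other positions as `ρ`. -/
def moveToLast {n : ℕ} (k : Fin (n + 1)) (ρ : Equiv.Perm (Fin n)) : Equiv.Perm (Fin (n + 1)) :=
  (finSuccEquiv' k).trans ((Equiv.optionCongr ρ).trans (finSuccEquiv' (Fin.last n)).symm)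

@[simp]
theorem moveToLast_self {n : ℕ} (k : Fin (n + 1)) (ρ : Equiv.Perm (Fin n)) :
    moveToLast k ρ k = Fin.last n := by
  simp [moveToLast]

@[simp]
theorem moveToLast_succAbove {n : ℕ} (k : Fin (n + 1)) (ρ : Equiv.Perm (Fin n)) (j : Fin n) :
    moveToLast k ρ (k.succAbove j) = (ρ j).castSucc := by
  simp [moveToLast]

theorem moveToLast_bijective (n : ℕ) :
    Function.Bijective fun p : Fin (n + 1) × Equiv.Perm (Fin n) => moveToLast p.1 p.2 := by
  rw [Fintype.bijective_iff_injective_and_card]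
  constructor
  · rintro ⟨k, ρ⟩ ⟨k', ρ'⟩ h
    simp only at h
    obtain rfl : k = k' := by
      apply (moveToLast k' ρ').injective
      rw [moveToLast_self, ← h, moveToLast_self]
    refine Prod.ext rfl (Equiv.ext fun j => ?_)
    have := Equiv.congr_fun h (k.succAbove j)
    simpa using this
  · simp [Fintype.card_perm, Nat.factorial_succ]

theorem permCoeff_eq_prod {n : ℕ} (τ : Equiv.Perm (Fin n)) (w : Fin n → Fin N) :
    permCoeff q τ w = ∏ a, ∏ b, if a < b ∧ τ b < τ a then (q (w a) (w b) : K) else 1 := by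
  rw [permCoeff, inversions, Finset.prod_filter, ← Finset.univ_product_univ, Finset.prod_product]

/-- The coefficient with which the letter in position `k` is braided to the right end of a word. -/
def moveCoeff {n : ℕ} (k : Fin n) (w : Fin n → Fin N) : K :=
  ∏ j, if k < j then (q (w k) (w j) : K) else 1

/-- Since k is sent to the largest value, its inversions are exactly the pairs (k, j) with j after
k; all others come from ρ. -/
theorem permCoeff_moveToLast {n : ℕ} (k : Fin (n + 1)) (ρ : Equiv.Perm (Fin n))
    (w : Fin (n + 1) → Fin N) :
    permCoeff q (moveToLast k ρ) w = moveCoeff q k w * permCoeff q ρ (w ∘ k.succAbove) := by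
  rw [permCoeff_eq_prod, permCoeff_eq_prod, moveCoeff, Fin.prod_univ_succAbove _ k]
  congr 1
  · refine Finset.prod_congr rfl fun j _ => if_congr ?_ rfl rfl
    rw [moveToLast_self]
    constructor
    · exact fun h => h.1
    · intro h
      obtain ⟨j, rfl⟩ := Fin.exists_succAbove_eq h.ne'
      exact ⟨h, by rw [moveToLast_succAbove]; exact Fin.castSucc_lt_last _⟩
  · refine Finset.prod_congr rfl fun a _ => ?_
    rw [Fin.prod_univ_succAbove _ k]
    simp only [moveToLast_self, moveToLast_succAbove, Fin.castSucc_lt_castSucc_iff,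
      Fin.succAbove_lt_succAbove_iff, Function.comp_apply]
    rw [if_neg, one_mul]
    exact fun h => (h.2.trans (Fin.castSucc_lt_last _)).false

theorem rightDeriv_monom_ofFn {n : ℕ} (i : Fin N) (w : Fin (n + 1) → Fin N) :
    rightDeriv v q i (monom v (List.ofFn w)) =
      ∑ k, (if w k = i then moveCoeff q k w else 0 : K) •
        monom v (List.ofFn (w ∘ k.succAbove)) := by
  induction n with
  | zero =>
    rw [Fin.sum_univ_succ]
    by_cases h : w 0 = i <;> simp [moveCoeff, rightDeriv_gen, h]
  | succ n ih =>
    rw [List.ofFn_succ, monom_cons, rightDeriv_gen_mul, ih, Fin.sum_univ_succ (n := n + 1),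
      add_comm, twist_monom, Finset.mul_sum]
    congr 1
    · have : moveCoeff q 0 w = (List.map (fun j => (q (w 0) j : K))
          (List.ofFn fun i => w i.succ)).prod := by
        rw [List.map_ofFn, List.prod_ofFn, moveCoeff, Fin.prod_univ_succ]
        simp
      rw [this]
      by_cases h : w 0 = i
      · simp [h, Function.comp_def]
      · simp [h]
    · refine Finset.sum_congr rfl fun k _ => ?_
      have h1 : moveCoeff q k.succ w = moveCoeff q k fun i => w i.succ := by
        rw [moveCoeff, moveCoeff, Fin.prod_univ_succ]
        simp
      have h2 : List.ofFn (w ∘ k.succ.succAbove) =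
          w 0 :: List.ofFn ((fun i => w i.succ) ∘ k.succAbove) := by
        rw [List.ofFn_succ]
        simp [Function.comp_def]
      rw [h1, h2, monom_cons, mul_smul_comm]

/-- The operator that `∂_i^R` induces on tensor powers. -/
noncomputable def tensorDeriv (n : ℕ) (i : Fin N) : (⨂[K]^(n + 1) V) →ₗ[K] ⨂[K]^n V :=
  (Basis.piTensorProduct fun _ : Fin (n + 1) => v).constr K fun w =>
    ∑ k, (if w k = i then moveCoeff q k w else 0 : K) • wordTensor v (w ∘ k.succAbove)

theorem tensorDeriv_wordTensor {n : ℕ} (i : Fin N) (w : Fin (n + 1) → Fin N) :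
    tensorDeriv v q n i (wordTensor v w) =
      ∑ k, (if w k = i then moveCoeff q k w else 0 : K) • wordTensor v (w ∘ k.succAbove) := by
  rw [← piTensorProduct_apply_eq_wordTensor, tensorDeriv, Basis.constr_basis]

theorem toTensorAlgebra_tensorDeriv {n : ℕ} (i : Fin N) (x : ⨂[K]^(n + 1) V) :
    TensorPower.toTensorAlgebra (tensorDeriv v q n i x) =
      rightDeriv v q i (TensorPower.toTensorAlgebra x) := by
  have : TensorPower.toTensorAlgebra ∘ₗ tensorDeriv v q n i =
      rightDeriv v q i ∘ₗ TensorPower.toTensorAlgebra :=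
    linearMap_ext_wordTensor v fun w => by
      simp only [LinearMap.comp_apply, tensorDeriv_wordTensor, map_sum, map_smul,
        toTensorAlgebra_wordTensor, rightDeriv_monom_ofFn]
  exact LinearMap.congr_fun this x

/-- `S_{n+1} = (S_n ⊗ id) T_{n+1}`. -/
theorem toTensorAlgebra_symmetrizer_succ {n : ℕ} (x : ⨂[K]^(n + 1) V) :
    TensorPower.toTensorAlgebra (symmetrizer v q (n + 1) x) =
      ∑ i, TensorPower.toTensorAlgebra (symmetrizer v q n (tensorDeriv v q n i x)) * gen v i := by
  have : TensorPower.toTensorAlgebra ∘ₗ symmetrizer v q (n + 1) =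
      ∑ i, LinearMap.mulRight K (gen v i) ∘ₗ TensorPower.toTensorAlgebra ∘ₗ
        symmetrizer v q n ∘ₗ tensorDeriv v q n i := by
    refine linearMap_ext_wordTensor v fun w => ?_
    simp only [LinearMap.comp_apply, LinearMap.sum_apply, LinearMap.mulRight_apply,
      tensorDeriv_wordTensor, map_sum, map_smul, symmetrizer_wordTensor,
      toTensorAlgebra_wordTensor]
    rw [Finset.sum_comm, ← (moveToLast_bijective n).sum_comp, Fintype.sum_prod_type]
    refine Finset.sum_congr rfl fun k _ => ?_
    -- For a fixed removed position k, only the derivation indexed by the letter w k contributes.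
    rw [Finset.sum_eq_single (w k) (fun i _ hi => by simp [Ne.symm hi]) (by simp), if_pos rfl,
      Finset.smul_sum]
    refine Finset.sum_congr rfl fun ρ _ => ?_
    have h1 : List.ofFn (w ∘ ((moveToLast k ρ)⁻¹ : Equiv.Perm (Fin (n + 1)))) =
        List.ofFn ((w ∘ k.succAbove) ∘ (ρ⁻¹ : Equiv.Perm (Fin n))) ++ [w k] := by
      have hlast : ((moveToLast k ρ)⁻¹ : Equiv.Perm (Fin (n + 1))) (Fin.last n) = k := by
        rw [Equiv.Perm.inv_eq_iff_eq, moveToLast_self]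
      have hcast : ∀ j : Fin n, ((moveToLast k ρ)⁻¹ : Equiv.Perm (Fin (n + 1))) j.castSucc =
          k.succAbove ((ρ⁻¹ : Equiv.Perm (Fin n)) j) := by
        intro j
        rw [Equiv.Perm.inv_eq_iff_eq, moveToLast_succAbove]
        simp
      rw [List.ofFn_succ', List.concat_eq_append]
      simp only [Function.comp_apply, hlast, hcast]
      rfl
    simp only [permCoeff_moveToLast, h1, monom_append, monom_cons, monom_nil, mul_one, mul_smul]
  simpa using LinearMap.congr_fun this x

/-- Both conditions obey one recursion: in positive degree each holds for x iff it holds for all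
∂_i^R(x). In degree 0, S_0 is the identity and the radical contains no nonzero scalar. -/
theorem symmetrizer_eq_zero_iff {n : ℕ} (x : ⨂[K]^n V) :
    symmetrizer v q n x = 0 ↔ TensorPower.toTensorAlgebra x ∈ radical v q := by
  induction n with
  | zero =>
    have h1 : symmetrizer v q 0 = LinearMap.id :=
      linearMap_ext_wordTensor v fun w => by
        rw [symmetrizer_wordTensor, Fintype.sum_unique]
        simp [permCoeff, inversions]
    rw [h1, LinearMap.id_apply]
    have hx : TensorPower.toTensorAlgebra x ∈ degreePart K V 0 := by
      rw [← range_toTensorAlgebra v]; exact ⟨x, rfl⟩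
    constructor
    · rintro rfl
      rw [map_zero]
      exact zero_mem _
    · intro h
      apply toTensorAlgebra_injective
      rw [map_zero, eq_algebraMap_counit v hx, ((mem_radical_iff_rightDeriv v q).1 h).1, map_zero]
  | succ n ih =>
    have hx : TensorPower.toTensorAlgebra x ∈ degreePart K V (n + 1) := by
      rw [← range_toTensorAlgebra v]; exact ⟨x, rfl⟩
    rw [← map_eq_zero_iff _ (toTensorAlgebra_injective (K := K) (V := V) (n + 1)),
      toTensorAlgebra_symmetrizer_succ, sum_mul_gen_eq_zero_iff, mem_radical_iff_rightDeriv]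
    simp only [map_eq_zero_iff _ (toTensorAlgebra_injective (K := K) (V := V) n), ih,
      toTensorAlgebra_tensorDeriv, counit_eq_zero_of_mem_degreePart v hx, true_and]

theorem kerSymmetrizer_eq (m : ℕ) :
    kerSymmetrizer v q m = radical v q ⊓ degreePart K V m := by
  rw [← range_toTensorAlgebra v]
  ext x
  constructor
  · rintro ⟨y, hy, rfl⟩
    exact ⟨(symmetrizer_eq_zero_iff v q y).1 hy, y, rfl⟩
  · rintro ⟨hx, y, rfl⟩
    exact ⟨y, (symmetrizer_eq_zero_iff v q y).2 hx, rfl⟩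

end Symmetrizer

end DiagonalNichols

/-! ### Assembly of the three statements. -/

theorem mainTheorem2 {K : Type*} [Field K] [CharZero K] {V : Type*} [AddCommGroup V] [Module K V]
    {N : ℕ} (v : Module.Basis (Fin N) K V) (q : Fin N → Fin N → Kˣ) :
    (∀ n : ℕ, 2 ≤ n → ∀ x : ⨂[K]^n V,
      (DiagonalNichols.rightDiffElement v q n x = 0 ↔
        ∀ i : Fin N, DiagonalNichols.rightDeriv v q i (TensorPower.toTensorAlgebra x) = 0) ∧
      (DiagonalNichols.leftDiffElement v q n x = 0 ↔
        ∀ i : Fin N, DiagonalNichols.leftDeriv v q i (TensorPower.toTensorAlgebra x) = 0)) ∧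
    (∀ m : ℕ, 2 ≤ m →
      DiagonalNichols.rightPart v q m = DiagonalNichols.kerSymmetrizer v q m ∧
      DiagonalNichols.leftPart v q m = DiagonalNichols.kerSymmetrizer v q m) ∧
    (∀ m : ℕ, 3 ≤ m → ∀ x ∈ DiagonalNichols.degreePart K V m,
      (x ∈ DiagonalNichols.rightPart v q m ↔
        ∀ i : Fin N, DiagonalNichols.rightDeriv v q i x ∈ DiagonalNichols.rightPart v q (m - 1)) ∧
      (x ∈ DiagonalNichols.leftPart v q m ↔
        ∀ i : Fin N,
          DiagonalNichols.leftDeriv v q i x ∈ DiagonalNichols.leftPart v q (m - 1))) := by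
  open DiagonalNichols in
  refine ⟨fun n _ x => ⟨rightDiffElement_eq_zero_iff v q x, leftDiffElement_eq_zero_iff v q x⟩,
    fun m hm => ?_, fun m hm x hx => ?_⟩
  · rw [rightPart_eq v q (by omega), leftPart_eq v q (by omega), kerSymmetrizer_eq]
    exact ⟨rfl, rfl⟩
  · obtain ⟨m, rfl⟩ : ∃ k, m = k + 1 := ⟨m - 1, by omega⟩
    rw [Nat.add_sub_cancel, rightPart_eq v q (by omega), rightPart_eq v q (by omega),
      leftPart_eq v q (by omega), leftPart_eq v q (by omega)]
    -- In positive degree the augmentation condition and the degree conditions are automatic, which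
    -- leaves the recursion that characterizes the radical.
    have hx0 := counit_eq_zero_of_mem_degreePart v hx
    simp only [Submodule.mem_inf, hx, and_true, rightDeriv_mem_degreePart v q _ hx,
      leftDeriv_mem_degreePart v q _ hx]
    constructor
    · rw [mem_radical_iff_rightDeriv]; simp [hx0]
    · rw [mem_radical_iff_leftDeriv]; simp [hx0]
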